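/- For a strict linear order $<$ let $C_<(a,b,c)$ denote $(a<b<c)\lor(b<c<a)\lor(c<a<b)$. A structure in a language containing $<$ is o-minimal if $<$ is a dense linear order without endpoints and every subset of its universe that is definable with parameters is a finite union of points and intervals; $T^{omin}_{\mathcal L}$ is the set of all $\mathcal L$-sentences true in every o-minimal $\mathcal L$-structure. Let $\mathcal L_0=\langle <,Z;S,P,\pi;c_1,c_2,c_3,c_4\rangle$ ($Z$ a unary predicate, $S,P,\pi$ unary function symbols, $c_i$ constants). The theory $T_0$ states: 1. $T^{omin}_{\mathcal L_0}$. 2. $<$ is a dense linear order without endpoints. 3. Every non-maximal (non-minimal) element of $Z$ has an immediate successor (predecessor) in $Z$. 4. Every $x\notin Z$ lies in an open interval disjoint from $Z$. 5. $\min Z=c_1$ and $\max Z=c_4$. 6. $c_2,c_3\in Z$, $c_1<c_2<c_3<c_4$, and there are infinitely many elements of $Z$ between any two of the $c_i$. 7. For all $x$, $\pi(x)\in Z$ and there is no $y\in Z$ with $C_<(x,y,\pi(x))$; moreover $\pi(x)=x$ for $x\in Z$. 8. $S(x)=x$ for $x\notin Z$; for $x\in Z$, $S(x)=y$ if and only if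 $y\in Z$, $y\ne x$ and there is no $z\in Z$ with $C_<(x,z,y)$. $P=S^{-1}$. Let $\mathcal L_1=\mathcal L_0\cup\{f,g\}$ with unary function symbols $f,g$. The theory $T_1$ is $T_0$ together with: 9. $f$ is bijective and $g=f^{-1}$. 10. $f(Z\cap[c_1,c_2])=Z\cap[c_3,c_4]$, and $f$ is order preserving on $Z\cap[c_1,c_2]$. 11. $f(Z\cap(c_2,c_4])=Z\cap[c_1,c_3)$, and $f$ is order preserving on $Z\cap(c_2,c_4]$. 12. For all $n>1$ and $z\in Z$, the sets $\{x\in Z: C_<(z,x,f^n(z))\}$ and $\{x\in Z: C_<(f^n(z),x,z)\}$ are infinite. 13. $f(x)=x$ for $x\notin Z$. 14. $C_<(f^m(z),f^n(z),z)$ for all $m>n>0$ and $z\in Z$. Let $\mathcal M_1$ be an arbitrary model of $T_1$, with universe $M$, and let $\mathcal M_0$ be its $\mathcal L_0$-reduct. Let $\mathcal M_2$ be the $\mathcal L_1$-structure with universe $M$ and the same $\mathcal L_0$-reduct $\mathcal M_0$, in which $$f^{\mathcal M_2}(x)=\begin{cases}P(f^{\mathcal M_1}(x)) & \text{if } S^n(x)=c_4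 \text{ for some } n\ge 0,\\ f^{\mathcal M_1}(x) & \text{otherwise,}\end{cases}\qquad g^{\mathcal M_2}(x)=\begin{cases}g^{\mathcal M_1}(S(x)) & \text{if } S^n(x)=P(c_3)\text{ for some } n\ge 0,\\ g^{\mathcal M_1}(x) & \text{otherwise.}\end{cases}$$ Then every subset of $M$ that is definable with parameters in $\mathcal M_2$ is definable with parameters in $\mathcal M_0$. -/

import Mathlib

open FirstOrder

namespace PseudoOMin

universe u v w

/-! ## Orders given by a binary relation -/

/-- `lt` is a dense (strict) linear order without endpoints on `M`. -/
structure IsDLO {M : Type w} (lt : M → M → Prop) : Prop where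
  irrefl : ∀ a, ¬ lt a a
  trans : ∀ a b c, lt a b → lt b c → lt a c
  total : ∀ a b, lt a b ∨ a = b ∨ lt b a
  dense : ∀ a b, lt a b → ∃ c, lt a c ∧ lt c b
  no_min : ∀ a, ∃ b, lt b a
  no_max : ∀ a, ∃ b, lt a b

/-- The cyclic order `C_<` induced by `<`. -/
def Cyc {M : Type w} (lt : M → M → Prop) (a b c : M) : Prop :=
  (lt a b ∧ lt b c) ∨ (lt b c ∧ lt c a) ∨ (lt c a ∧ lt a b)

/-- `I` is a point, or an open interval with endpoints in `M ∪ {-∞, +∞}`. -/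
def IsPointOrInterval {M : Type w} (lt : M → M → Prop) (I : Set M) : Prop :=
  (∃ a, I = {a}) ∨ (∃ a b, I = {x | lt a x ∧ lt x b}) ∨
    (∃ a, I = {x | lt a x}) ∨ (∃ b, I = {x | lt x b}) ∨ I = Set.univ

/-! ## o-minimality and the common theory of o-minimal structures -/

/-- The `L`-structure `M` is o-minimal with respect to the binary relation symbol `lt`: `lt` is a
dense linear order without endpoints, and every subset of `M` definable with parameters is a
finite union of points and intervals. -/
structure IsOMinimal (L : FirstOrder.Language.{u, v}) (lt : L.Relations 2) (M : Type w) [L.Structure M] :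
    Prop where
  nonempty : Nonempty M
  dlo : IsDLO (fun a b : M => Language.Structure.RelMap lt ![a, b])
  finite_union : ∀ X : Set M, Set.Definable₁ Set.univ L X →
    ∃ F : Set (Set M), F.Finite ∧
      (∀ I ∈ F, IsPointOrInterval (fun a b : M => Language.Structure.RelMap lt ![a, b]) I) ∧
      X = ⋃₀ F

/-- The theory `T^omin_L` of all `L`-sentences satisfied in every o-minimal `L`-structure. -/
def Tomin (L : FirstOrder.Language.{u, v}) (lt : L.Relations 2) : L.Theory :=
  {φ | ∀ (N : Type w) [L.Structure N], IsOMinimal L lt N → N ⊨ φ}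

/-! ## The language `L₀` -/

/-- Function symbols of `L₀`: constants `c₁, c₂, c₃, c₄`; unary `S`, `P` and `π` (`proj`). -/
inductive Func0 : ℕ → Type
  | c1 : Func0 0
  | c2 : Func0 0
  | c3 : Func0 0
  | c4 : Func0 0
  | S : Func0 1
  | P : Func0 1
  | proj : Func0 1

/-- Relation symbols of `L₀`: the unary `Z` and the binary `<`. -/
inductive Rel0 : ℕ → Type
  | Z : Rel0 1
  | lt : Rel0 2

/-- `L₀ = ⟨<, Z; S, P, π; c₁, c₂, c₃, c₄⟩`. -/
def L0 : FirstOrder.Language.{0, 0} := ⟨Func0, Rel0⟩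

section Interpretations

variable {M : Type w} [L0.Structure M]

/-- The interpretation of `<`. -/
def lt0 (a b : M) : Prop := Language.Structure.RelMap (L := L0) Rel0.lt ![a, b]

/-- `a ≤ b`. -/
def le0 (a b : M) : Prop := lt0 a b ∨ a = b

/-- The interpretation of `Z`, as a subset of `M`. -/
def Z0 (M : Type w) [L0.Structure M] : Set M :=
  {a | Language.Structure.RelMap (L := L0) Rel0.Z ![a]}

/-- The interpretation of `S`. -/
def S0 (a : M) : M := Language.Structure.funMap (L := L0) Func0.S ![a]

/-- The interpretation of `P`. -/
def P0 (a : M) : M := Language.Structure.funMap (L := L0) Func0.P ![a]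

/-- The interpretation of `π`. -/
def proj0 (a : M) : M := Language.Structure.funMap (L := L0) Func0.proj ![a]

/-- The interpretation of `c₁`. -/
def c1 (M : Type w) [L0.Structure M] : M := Language.Structure.funMap (L := L0) Func0.c1 ![]

/-- The interpretation of `c₂`. -/
def c2 (M : Type w) [L0.Structure M] : M := Language.Structure.funMap (L := L0) Func0.c2 ![]

/-- The interpretation of `c₃`. -/
def c3 (M : Type w) [L0.Structure M] : M := Language.Structure.funMap (L := L0) Func0.c3 ![]

/-- The interpretation of `c₄`. -/
def c4 (M : Type w) [L0.Structure M] : M := Language.Structure.funMap (L := L0) Func0.c4 ![]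

end Interpretations

/-! ## Models of `T₀` -/

/-- The `L₀`-structure `M` is a model of `T₀`. -/
structure ModelsT0 (M : Type w) [L0.Structure M] : Prop where
  /-- `M` satisfies every sentence that holds in all o-minimal `L₀`-structures. -/
  tomin : M ⊨ Tomin.{0, 0, w} L0 Rel0.lt
  dlo : IsDLO (lt0 : M → M → Prop)
  /-- Every non-maximal element of `Z` has an immediate successor in `Z`. -/
  discrete_succ : ∀ z ∈ Z0 M, (∃ w ∈ Z0 M, lt0 z w) →
    ∃ w ∈ Z0 M, lt0 z w ∧ ∀ y ∈ Z0 M, ¬ (lt0 z y ∧ lt0 y w)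
  /-- Every non-minimal element of `Z` has an immediate predecessor in `Z`. -/
  discrete_pred : ∀ z ∈ Z0 M, (∃ w ∈ Z0 M, lt0 w z) →
    ∃ w ∈ Z0 M, lt0 w z ∧ ∀ y ∈ Z0 M, ¬ (lt0 w y ∧ lt0 y z)
  closed : ∀ x, x ∉ Z0 M → ∃ a b, lt0 a x ∧ lt0 x b ∧ ∀ y, lt0 a y → lt0 y b → y ∉ Z0 M
  min_eq : c1 M ∈ Z0 M ∧ ∀ z ∈ Z0 M, le0 (c1 M) z
  max_eq : c4 M ∈ Z0 M ∧ ∀ z ∈ Z0 M, le0 z (c4 M)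
  c2_mem : c2 M ∈ Z0 M
  c3_mem : c3 M ∈ Z0 M
  c1_lt_c2 : lt0 (c1 M) (c2 M)
  c2_lt_c3 : lt0 (c2 M) (c3 M)
  c3_lt_c4 : lt0 (c3 M) (c4 M)
  inf12 : {z ∈ Z0 M | lt0 (c1 M) z ∧ lt0 z (c2 M)}.Infinite
  inf23 : {z ∈ Z0 M | lt0 (c2 M) z ∧ lt0 z (c3 M)}.Infinite
  inf34 : {z ∈ Z0 M | lt0 (c3 M) z ∧ lt0 z (c4 M)}.Infinite
  /-- `π` is the cyclic forward projection on `Z`. -/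
  proj_spec : ∀ x : M, proj0 x ∈ Z0 M ∧ ∀ y ∈ Z0 M, ¬ Cyc lt0 x y (proj0 x)
  proj_of_mem : ∀ x ∈ Z0 M, proj0 x = x
  /-- `S` is the cyclic successor function on `Z` and the identity outside of `Z`. -/
  S_spec : ∀ x y : M, S0 x = y ↔ (x ∉ Z0 M ∧ x = y) ∨
    (x ∈ Z0 M ∧ y ∈ Z0 M ∧ x ≠ y ∧ ¬ ∃ z ∈ Z0 M, Cyc lt0 x z y)
  /-- `P` is the inverse of `S`. -/
  P_S : ∀ x : M, P0 (S0 x) = x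
  S_P : ∀ x : M, S0 (P0 x) = x

/-! ## The language `L₁` and models of `T₁` -/

/-- The two additional unary function symbols `f`, `g`. -/
inductive FuncFG : ℕ → Type
  | f : FuncFG 1
  | g : FuncFG 1

/-- The language `{f, g}`. -/
def Lfg : FirstOrder.Language.{0, 0} := ⟨FuncFG, fun _ => Empty⟩

/-- `L₁ = L₀ ∪ {f, g}`. -/
def L1 : FirstOrder.Language.{0, 0} := L0.sum Lfg

/-- The `L₀`-reduct `𝓜₀` of an `L₁`-structure `𝓜₁`. -/
@[reducible] def reduct0 {M : Type w} (𝓜₁ : L1.Structure M) : L0.Structure M :=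
  @Language.LHom.reduct L0 L1 (Language.LHom.sumInl : L0 →ᴸ L0.sum Lfg) M 𝓜₁

/-- The interpretation of `f` in an `L₁`-structure. -/
def fOf {M : Type w} (𝓜₁ : L1.Structure M) (x : M) : M :=
  𝓜₁.funMap (Sum.inr FuncFG.f : L1.Functions 1) ![x]

/-- The interpretation of `g` in an `L₁`-structure. -/
def gOf {M : Type w} (𝓜₁ : L1.Structure M) (x : M) : M :=
  𝓜₁.funMap (Sum.inr FuncFG.g : L1.Functions 1) ![x]

/-- The axioms of `T₁` on `f` and `g`, over an `L₀`-structure `M`. -/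
structure AxiomsFG (M : Type w) [L0.Structure M] (f g : M → M) : Prop where
  f_bij : Function.Bijective f
  /-- `g` is the inverse of `f`. -/
  g_f : ∀ x, g (f x) = x
  f_g : ∀ x, f (g x) = x
  image12 : f '' {z ∈ Z0 M | le0 (c1 M) z ∧ le0 z (c2 M)} =
    {z ∈ Z0 M | le0 (c3 M) z ∧ le0 z (c4 M)}
  iso12 : ∀ x ∈ {z ∈ Z0 M | le0 (c1 M) z ∧ le0 z (c2 M)},
    ∀ y ∈ {z ∈ Z0 M | le0 (c1 M) z ∧ le0 z (c2 M)}, lt0 x y ↔ lt0 (f x) (f y)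
  image24 : f '' {z ∈ Z0 M | lt0 (c2 M) z ∧ le0 z (c4 M)} =
    {z ∈ Z0 M | le0 (c1 M) z ∧ lt0 z (c3 M)}
  iso24 : ∀ x ∈ {z ∈ Z0 M | lt0 (c2 M) z ∧ le0 z (c4 M)},
    ∀ y ∈ {z ∈ Z0 M | lt0 (c2 M) z ∧ le0 z (c4 M)}, lt0 x y ↔ lt0 (f x) (f y)
  /-- `z` and `f^n(z)` are infinitely far apart in `Z`, in both directions of the cycle. -/
  far : ∀ n : ℕ, 1 < n → ∀ z ∈ Z0 M,
    {x ∈ Z0 M | Cyc lt0 z x (f^[n] z)}.Infinite ∧ {x ∈ Z0 M | Cyc lt0 (f^[n] z) x z}.Infinite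
  f_id : ∀ x, x ∉ Z0 M → f x = x
  circular : ∀ m n : ℕ, 0 < n → n < m → ∀ z ∈ Z0 M, Cyc lt0 (f^[m] z) (f^[n] z) z

/-- The `L₁`-structure `𝓜₁` is a model of `T₁`. -/
structure ModelsT1 {M : Type w} (𝓜₁ : L1.Structure M) : Prop where
  modelsT0 : @ModelsT0 M (reduct0 𝓜₁)
  axiomsFG : @AxiomsFG M (reduct0 𝓜₁) (fOf 𝓜₁) (gOf 𝓜₁)

/-! ## The structure `𝓜₂` -/

open Classical in
/-- `f` shifted down by one element on `{x | S^n(x) = c₄ for some n ≥ 0}`. -/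
noncomputable def shiftF {M : Type w} [L0.Structure M] (f : M → M) (x : M) : M :=
  if ∃ n : ℕ, S0^[n] x = c4 M then P0 (f x) else f x

open Classical in
/-- `g` precomposed with `S` on `{x | S^n(x) = P(c₃) for some n ≥ 0}`. -/
noncomputable def shiftG {M : Type w} [L0.Structure M] (g : M → M) (x : M) : M :=
  if ∃ n : ℕ, S0^[n] x = P0 (c3 M) then g (S0 x) else g x

/-- The `{f, g}`-structure on `M` given by two functions. -/
@[reducible] def structureFG {M : Type w} (f g : M → M) : Lfg.Structure M where
  funMap := fun {_} s => match s with
    | FuncFG.f => fun v => f (v 0)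
    | FuncFG.g => fun v => g (v 0)
  RelMap := fun {_} r => r.elim

/-- The `L₁`-structure `𝓜₂`: it has the same `L₀`-reduct as `𝓜₁`, and its `f` and `g` are the
shifts of those of `𝓜₁`. -/
@[reducible] noncomputable def structure2 {M : Type w} (𝓜₁ : L1.Structure M) : L1.Structure M :=
  @Language.sumStructure L0 Lfg M (reduct0 𝓜₁)
    (structureFG (@shiftF M (reduct0 𝓜₁) (fOf 𝓜₁)) (@shiftG M (reduct0 𝓜₁) (gOf 𝓜₁)))

end PseudoOMin

namespace PseudoOMin

universe u v w

/-! The proof is a back-and-forth argument inside `𝓜₂` that tracks how many operations have been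
applied.

In `𝓜₁` the map `f` is a cyclic rotation of `Z`, so it commutes with `S`, and `f c₄ = P c₃`.
Shifting `f` down by one on the points finitely far below `c₄` leaves a gap: on `Z` the new `f` is
injective and misses `P c₃`. Since only finite distances change, the new `f` keeps three properties:
it is increasing on `Z ∩ [c₁,c₂]` and on `Z ∩ (c₂,c₄]`, its iterates keep their cyclic order, and
`fⁿ z` is never finitely many `S`-steps from `z`. It still commutes with `S` except at `c₄`, and `g`
inverts it except at `P c₃`. `ShiftedRotation` records these facts; the two exceptional points are
terms in the constants.

Let `R` be a finite set of pairs containing all `(cᵢ,cᵢ)`, and let `cl R n` be its closure under `n`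
rounds of the unary operations, each applied to both components. If a large closure is a partial
isomorphism for `<` and `Z`, then any `a` has a partner `b` such that a smaller closure of `R ∪
{(a,b)}` is one too (`exists_insert`). For `a ∈ Z` it suffices that `b ∈ Z` fills the corresponding
cut of a large closure (`Cut.pIso_cl_insert`). Each operation carries cuts to cuts at the cost of
one round. Within the new orbit every point is `fⁿ Sᵏ β` for one `β` far enough back, and the order
of two such points depends only on exponents and on comparisons of iterates with `c₂`
(`Cut.lt_iff_of_le`). A point outside `Z` is fixed by everything but `π`, so its partner is found
after that of its projection.

By induction every formula respects partial isomorphisms of sufficient depth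
(`Interprets.exists_realize_iff`). Applied to identity pairs on the parameters together with
`(x,x')`, this shows that membership in a definable set depends only on whether `x ∈ Z` and on the
positions of `x` and `π(x)` relative to finitely many points. Such a set is a finite Boolean
combination of `L0`-definable sets. -/

/-- A discrete set `Z` with endpoints inside a linear order, with cyclic successor, predecessor and
projection, and a map `f` from `Z` onto `Z \ {P c₃}` that rotates `Z` cyclically. -/
structure ShiftedRotation (M : Type w) [LinearOrder M] where
  Z : Set M
  S : M → M
  P : M → M
  proj : M → M
  f : M → M
  g : M → M
  c1 : M
  c2 : M
  c3 : M
  c4 : M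
  c1_mem : c1 ∈ Z
  c2_mem : c2 ∈ Z
  c3_mem : c3 ∈ Z
  c4_mem : c4 ∈ Z
  c1_le : ∀ z ∈ Z, c1 ≤ z
  le_c4 : ∀ z ∈ Z, z ≤ c4
  c1_lt_c2 : c1 < c2
  c2_lt_c3 : c2 < c3
  c3_lt_c4 : c3 < c4
  P_S : ∀ x, P (S x) = x
  S_P : ∀ x, S (P x) = x
  S_mem : ∀ z ∈ Z, S z ∈ Z
  P_mem : ∀ z ∈ Z, P z ∈ Z
  S_off : ∀ x, x ∉ Z → S x = x
  lt_S : ∀ z ∈ Z, z ≠ c4 → z < S z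
  S_le : ∀ z ∈ Z, ∀ w ∈ Z, z < w → S z ≤ w
  S_c4 : S c4 = c1
  proj_mem : ∀ x, proj x ∈ Z
  proj_of_mem : ∀ x ∈ Z, proj x = x
  le_proj : ∀ x, x ≤ c4 → x ≤ proj x
  proj_le : ∀ x, ∀ z ∈ Z, x ≤ z → proj x ≤ z
  proj_gt : ∀ x, c4 < x → proj x = c1
  f_mem : ∀ z ∈ Z, f z ∈ Z
  g_mem : ∀ z ∈ Z, g z ∈ Z
  f_off : ∀ x, x ∉ Z → f x = x
  g_off : ∀ x, x ∉ Z → g x = x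
  g_f : ∀ x, g (f x) = x
  f_g : ∀ x, x ≠ P c3 → f (g x) = x
  c3_le_f : ∀ z ∈ Z, z ≤ c2 → c3 ≤ f z
  f_lt : ∀ z ∈ Z, c2 < z → f z < P c3
  f_mono_low : ∀ x ∈ Z, ∀ y ∈ Z, y ≤ c2 → x < y → f x < f y
  f_mono_high : ∀ x ∈ Z, ∀ y ∈ Z, c2 < x → x < y → f x < f y
  f_S : ∀ x, x ≠ c4 → f (S x) = S (f x)
  circ : ∀ m n : ℕ, 0 < n → n < m → ∀ z ∈ Z, Cyc (· < ·) (f^[m] z) (f^[n] z) z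
  far : ∀ n : ℕ, 0 < n → ∀ z ∈ Z, ∀ k l : ℕ, S^[k] (f^[n] z) ≠ S^[l] z

namespace ShiftedRotation

variable {M : Type w} [LinearOrder M] (A : ShiftedRotation M)

/-! ### Elementary properties of shifted rotations -/

lemma P_off {x : M} (hx : x ∉ A.Z) : A.P x = x := by
  conv_lhs => rw [← A.S_off x hx]
  exact A.P_S x

lemma iterate_mem {h : M → M} (hh : ∀ z ∈ A.Z, h z ∈ A.Z) {z : M} (hz : z ∈ A.Z) (n : ℕ) :
    h^[n] z ∈ A.Z := by
  induction n with
  | zero => exact hz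
  | succ n ih => rw [Function.iterate_succ_apply']; exact hh _ ih

lemma P_c3_lt : A.P A.c3 < A.c3 := by
  have h1 := A.lt_S (A.P A.c3) (A.P_mem _ A.c3_mem) (by
    intro h
    have h2 := A.S_P A.c3
    rw [h, A.S_c4] at h2
    exact absurd h2 (A.c1_lt_c2.trans A.c2_lt_c3).ne)
  rwa [A.S_P] at h1

lemma lt_P_c3_or {z : M} (hz : z ∈ A.Z) : z < A.P A.c3 ∨ z = A.P A.c3 ∨ A.c3 ≤ z := by
  rcases lt_trichotomy z (A.P A.c3) with h | h | h
  · exact .inl h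
  · exact .inr (.inl h)
  · right; right
    have := A.S_le _ (A.P_mem _ A.c3_mem) _ hz h
    rwa [A.S_P] at this

lemma g_le {z : M} (hz : z ∈ A.Z) (h : A.c3 ≤ z) : A.g z ≤ A.c2 := by
  by_contra! h'
  have h1 := A.f_lt _ (A.g_mem _ hz) h'
  have h2 := A.P_c3_lt
  rw [A.f_g _ (by order)] at h1
  order

lemma lt_g {z : M} (hz : z ∈ A.Z) (h : z < A.P A.c3) : A.c2 < A.g z := by
  by_contra! h'
  have h1 := A.c3_le_f _ (A.g_mem _ hz) h'
  have h2 := A.P_c3_lt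
  rw [A.f_g _ (by order)] at h1
  order

lemma f_lt_f_low {x y : M} (hx : x ∈ A.Z) (hy : y ∈ A.Z) (hxc : x ≤ A.c2) (hyc : y ≤ A.c2) :
    A.f x < A.f y ↔ x < y := by
  refine ⟨fun h => ?_, A.f_mono_low x hx y hy hyc⟩
  by_contra! h'
  rcases h'.eq_or_lt with rfl | h'
  · exact lt_irrefl _ h
  · exact lt_asymm h (A.f_mono_low y hy x hx hxc h')

lemma f_lt_f_high {x y : M} (hx : x ∈ A.Z) (hy : y ∈ A.Z) (hxc : A.c2 < x) (hyc : A.c2 < y) :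
    A.f x < A.f y ↔ x < y := by
  refine ⟨fun h => ?_, A.f_mono_high x hx y hy hxc⟩
  by_contra! h'
  rcases h'.eq_or_lt with rfl | h'
  · exact lt_irrefl _ h
  · exact lt_asymm h (A.f_mono_high y hy x hx hyc h')

/-! ### Comparing points of one orbit -/

lemma S_lt_iff {x y : M} (hx : x ∈ A.Z) (hy : y ∈ A.Z) (h4 : x ≠ A.c4) (hne : A.S x ≠ y) :
    A.S x < y ↔ x < y :=
  ⟨(A.lt_S x hx h4).trans, fun h => lt_of_le_of_ne (A.S_le x hx y hy h) hne⟩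

lemma lt_S_iff {x y : M} (hx : x ∈ A.Z) (hy : y ∈ A.Z) (h4 : y ≠ A.c4) (hne : x ≠ y) :
    x < A.S y ↔ x < y := by
  refine ⟨fun h => ?_, fun h => h.trans (A.lt_S y hy h4)⟩
  by_contra! h'
  exact absurd (A.S_le y hy x hx (lt_of_le_of_ne h' hne.symm)) (not_le.2 h)

/-- As long as `c4` is not passed, a step of `S` crosses no other point of `Z`, so it cannot change
the order between different `S`-orbits. -/
lemma iterate_S_lt_iff {x y : M} (hx : x ∈ A.Z) (hy : y ∈ A.Z) (k l : ℕ)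
    (hxk : ∀ i < k, A.S^[i] x ≠ A.c4) (hyl : ∀ i < l, A.S^[i] y ≠ A.c4)
    (hne : ∀ i j, A.S^[i] x ≠ A.S^[j] y) :
    A.S^[k] x < A.S^[l] y ↔ x < y := by
  induction k with
  | zero =>
    induction l with
    | zero => rfl
    | succ l ih =>
      rw [Function.iterate_succ_apply', Function.iterate_zero_apply,
        A.lt_S_iff hx (A.iterate_mem A.S_mem hy l) (hyl l (by omega)) (hne 0 l)]
      exact ih fun i hi => hyl i (by omega)
  | succ k ih =>
    rw [Function.iterate_succ_apply', A.S_lt_iff (A.iterate_mem A.S_mem hx k)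
      (A.iterate_mem A.S_mem hy l) (hxk k (by omega))
      (by rw [← Function.iterate_succ_apply' A.S]; exact hne _ _)]
    exact ih fun i hi => hxk i (by omega)

lemma iterate_S_strictMono {x : M} (hx : x ∈ A.Z) {k l : ℕ} (hkl : k < l)
    (h4 : ∀ i < l, A.S^[i] x ≠ A.c4) : A.S^[k] x < A.S^[l] x := by
  induction l with
  | zero => omega
  | succ l ih =>
    have h1 : A.S^[l] x < A.S^[l + 1] x := by
      rw [Function.iterate_succ_apply']
      exact A.lt_S _ (A.iterate_mem A.S_mem hx l) (h4 l (by omega))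
    rcases Nat.lt_succ_iff_lt_or_eq.1 hkl with h | rfl
    · exact (ih h fun i hi => h4 i (by omega)).trans h1
    · exact h1

lemma iterate_S_lt_iterate_S_iff {x : M} (hx : x ∈ A.Z) {k l n : ℕ} (hk : k ≤ n) (hl : l ≤ n)
    (h4 : ∀ i < n, A.S^[i] x ≠ A.c4) : A.S^[k] x < A.S^[l] x ↔ k < l := by
  refine ⟨fun h => ?_, fun h => A.iterate_S_strictMono hx h fun i hi => h4 i (by omega)⟩
  by_contra! h'
  rcases h'.eq_or_lt with rfl | h'
  · exact lt_irrefl _ h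
  · exact lt_asymm h (A.iterate_S_strictMono hx h' fun i hi => h4 i (by omega))

/-- Points up to `c2` jump to `c3` or beyond. A point above `c2` cannot move up: monotonicity would
give `z < f z < f (f z)`, against `circ`. -/
lemma lt_f_iff {z : M} (hz : z ∈ A.Z) : z < A.f z ↔ z ≤ A.c2 := by
  have h2 := A.c2_lt_c3
  have h3 := A.P_c3_lt
  constructor
  · intro h
    by_contra! h'
    have hc : A.f A.c4 < A.P A.c3 := A.f_lt _ A.c4_mem (A.c2_lt_c3.trans A.c3_lt_c4)
    have h1 := A.f_lt z hz h'
    have h5 := A.circ 2 1 one_pos one_lt_two z hz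
    have h6 : A.c2 < A.f z := h'.trans h
    have h7 := A.f_mono_high z hz _ (A.f_mem z hz) h' h
    simp only [Function.iterate_succ_apply, Function.iterate_zero_apply, Cyc] at h5
    rcases h5 with h5 | h5 | h5 <;> order
  · intro h
    exact (h.trans_lt h2).trans_le (A.c3_le_f z hz h)

/-- By `circ`, `z` lies below `f^[n + 1] z` exactly when it lies below `f^[n] z` or the last step
goes up. The order within an orbit is thus reduced to comparisons with the constant `c2`. -/
lemma lt_iterate_f_iff {z : M} (hz : z ∈ A.Z) {n : ℕ} (hn : 0 < n) :
    z < A.f^[n] z ↔ ∃ i < n, A.f^[i] z ≤ A.c2 := by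
  induction n with
  | zero => omega
  | succ n ih =>
    rcases Nat.eq_zero_or_pos n with rfl | hpos
    · simpa using A.lt_f_iff hz
    · have hm := A.iterate_mem A.f_mem hz n
      have hcirc := A.circ (n + 1) n hpos (by omega) z hz
      have hne : A.f^[n] z ≠ z := A.far n hpos z hz 0 0
      have hf := A.lt_f_iff hm
      rw [← Function.iterate_succ_apply' A.f] at hf
      have hne' : A.f^[n + 1] z ≠ A.f^[n] z := by
        rw [Function.iterate_succ_apply']
        exact A.far 1 one_pos _ hm 0 0
      have key : z < A.f^[n + 1] z ↔ z < A.f^[n] z ∨ A.f^[n] z < A.f^[n + 1] z := by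
        unfold Cyc at hcirc
        constructor
        · intro h
          by_contra! h'
          rcases hcirc with h5 | h5 | h5 <;> order
        · rintro (h | h) <;> rcases hcirc with h5 | h5 | h5 <;> order
      rw [key, ih hpos, hf]
      constructor
      · rintro (⟨i, hi, h⟩ | h)
        · exact ⟨i, by omega, h⟩
        · exact ⟨n, by omega, h⟩
      · rintro ⟨i, hi, h⟩
        rcases Nat.lt_succ_iff_lt_or_eq.1 hi with h' | rfl
        · exact .inl ⟨i, h', h⟩
        · exact .inr h

/-! ### Closures of sets of pairs -/

/-- The unary operations. -/
def ops : Set (M → M) := {A.S, A.P, A.proj, A.f, A.g}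

/-- The pairs obtained from those in `R` by at most `n` simultaneous applications of operations. -/
def cl (R : Set (M × M)) : ℕ → Set (M × M)
  | 0 => R
  | n + 1 => cl R n ∪ {p | ∃ h ∈ A.ops, ∃ q ∈ cl R n, p = Prod.map h h q}

variable {A} {R R' Q Q' : Set (M × M)}

lemma cl_succ_of_mem {n : ℕ} {p : M × M} (hp : p ∈ A.cl R n) : p ∈ A.cl R (n + 1) := .inl hp

lemma cl_mono {m n : ℕ} (h : m ≤ n) : A.cl R m ⊆ A.cl R n := by
  induction h with
  | refl => exact subset_rfl
  | step _ ih => exact ih.trans fun _ => cl_succ_of_mem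

lemma subset_cl (n : ℕ) : R ⊆ A.cl R n := cl_mono (Nat.zero_le n)

lemma map_mem_cl {n : ℕ} {h : M → M} (hh : h ∈ A.ops) {p : M × M} (hp : p ∈ A.cl R n) :
    Prod.map h h p ∈ A.cl R (n + 1) := .inr ⟨h, hh, p, hp, rfl⟩

lemma S_mem_ops : A.S ∈ A.ops := by simp [ops]
lemma P_mem_ops : A.P ∈ A.ops := by simp [ops]
lemma proj_mem_ops : A.proj ∈ A.ops := by simp [ops]
lemma f_mem_ops : A.f ∈ A.ops := by simp [ops]
lemma g_mem_ops : A.g ∈ A.ops := by simp [ops]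

lemma cl_subset_cl {m n : ℕ} (h : R' ⊆ A.cl R m) : A.cl R' n ⊆ A.cl R (m + n) := by
  induction n with
  | zero => exact h
  | succ n ih =>
    rintro p (hp | ⟨h, hh, q, hq, rfl⟩)
    · exact cl_succ_of_mem (ih hp)
    · exact map_mem_cl hh (ih hq)

lemma cl_subset_of_subset {n : ℕ} (h : R' ⊆ R) : A.cl R' n ⊆ A.cl R n := by
  have := cl_subset_cl (A := A) (m := 0) (n := n) (R := R) h
  rwa [Nat.zero_add] at this

lemma cl_insert {n : ℕ} {p : M × M} : A.cl (insert p R) n ⊆ A.cl R n ∪ A.cl {p} n := by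
  induction n with
  | zero =>
    rintro q (rfl | hq)
    · exact .inr rfl
    · exact .inl hq
  | succ n ih =>
    rintro q (hq | ⟨h, hh, q, hq, rfl⟩)
    · exact (ih hq).imp cl_succ_of_mem cl_succ_of_mem
    · exact (ih hq).imp (map_mem_cl hh) (map_mem_cl hh)

lemma cl_finite (hR : R.Finite) (n : ℕ) : (A.cl R n).Finite := by
  induction n with
  | zero => exact hR
  | succ n ih =>
    refine ih.union ?_
    have h5 : A.ops.Finite := by simp [ops]
    refine (h5.biUnion fun h _ => ih.image (Prod.map h h)).subset ?_
    rintro p ⟨h, hh, q, hq, rfl⟩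
    exact Set.mem_biUnion hh ⟨q, hq, rfl⟩

lemma cl_swap (n : ℕ) : A.cl (Prod.swap ⁻¹' R) n = Prod.swap ⁻¹' A.cl R n := by
  induction n with
  | zero => rfl
  | succ n ih =>
    ext p
    simp only [cl, ih, Set.mem_union, Set.mem_preimage, Set.mem_ofPred_eq]
    refine or_congr_right ⟨?_, ?_⟩
    · rintro ⟨h, hh, q, hq, rfl⟩
      exact ⟨h, hh, q.swap, hq, rfl⟩
    · rintro ⟨h, hh, q, hq, hp⟩
      refine ⟨h, hh, q.swap, by simpa using hq, ?_⟩
      rw [← Prod.swap_swap p, hp]; rfl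

lemma cl_diag (hR : ∀ p ∈ R, p.1 = p.2) (n : ℕ) : ∀ p ∈ A.cl R n, p.1 = p.2 := by
  induction n with
  | zero => exact hR
  | succ n ih =>
    rintro p (hp | ⟨h, hh, q, hq, rfl⟩)
    · exact ih p hp
    · simp [ih q hq]

variable (A) in
/-- The pairs in `Q` form a partial isomorphism for `<` and `Z`. -/
structure PIso (Q : Set (M × M)) : Prop where
  lt_iff : ∀ p ∈ Q, ∀ q ∈ Q, p.1 < q.1 ↔ p.2 < q.2
  mem_iff : ∀ p ∈ Q, p.1 ∈ A.Z ↔ p.2 ∈ A.Z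

lemma PIso.mono (h : A.PIso Q) (hs : Q' ⊆ Q) : A.PIso Q' :=
  ⟨fun p hp q hq => h.lt_iff p (hs hp) q (hs hq), fun p hp => h.mem_iff p (hs hp)⟩

lemma PIso.swap (h : A.PIso Q) : A.PIso (Prod.swap ⁻¹' Q) :=
  ⟨fun _ hp _ hq => (h.lt_iff _ hp _ hq).symm, fun _ hp => (h.mem_iff _ hp).symm⟩

lemma PIso.eq_iff (h : A.PIso Q) {p q : M × M} (hp : p ∈ Q) (hq : q ∈ Q) :
    p.1 = q.1 ↔ p.2 = q.2 := by
  have h1 := h.lt_iff p hp q hq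
  have h2 := h.lt_iff q hq p hp
  constructor <;> intro h3 <;> rw [h3] at h1 h2 <;> simp only [lt_irrefl, false_iff,
    iff_false] at h1 h2 <;> order

variable (A) in
/-- The set of pairs `(cᵢ, cᵢ)`. -/
def consts : Set (M × M) := {(A.c1, A.c1), (A.c2, A.c2), (A.c3, A.c3), (A.c4, A.c4)}

lemma c1_mem_consts : (A.c1, A.c1) ∈ A.consts := by simp [consts]
lemma c2_mem_consts : (A.c2, A.c2) ∈ A.consts := by simp [consts]
lemma c3_mem_consts : (A.c3, A.c3) ∈ A.consts := by simp [consts]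
lemma c4_mem_consts : (A.c4, A.c4) ∈ A.consts := by simp [consts]

variable (A) in
/-- The components of `p` lie in `Z` and fill corresponding cuts of the pairs in `Q`. -/
def Cut (Q : Set (M × M)) (p : M × M) : Prop :=
  p.1 ∈ A.Z ∧ p.2 ∈ A.Z ∧
    ∀ q ∈ Q, q.1 ∈ A.Z → (q.1 < p.1 ↔ q.2 < p.2) ∧ q.1 ≠ p.1 ∧ q.2 ≠ p.2

lemma Cut.mono {p : M × M} (h : A.Cut Q p) (hs : Q' ⊆ Q) : A.Cut Q' p :=
  ⟨h.1, h.2.1, fun q hq => h.2.2 q (hs hq)⟩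

/-! ### Operations preserve cuts, losing one round of closure -/

section CutSteps

variable {n : ℕ} {p : M × M}

/-- A point of the smaller closure differs from `S p` because its image under `P`, one round
further, differs from `p`. Since `p` avoids `c4`, the step does not wrap around. -/
lemma Cut.map_S (hc : A.consts ⊆ R) (hQ : A.PIso (A.cl R (n + 1)))
    (h : A.Cut (A.cl R (n + 1)) p) : A.Cut (A.cl R n) (Prod.map A.S A.S p) := by
  obtain ⟨h1, h2, h3⟩ := h
  have h4 := h3 _ (subset_cl _ (hc c4_mem_consts)) A.c4_mem
  refine ⟨A.S_mem _ h1, A.S_mem _ h2, fun q hq hqZ => ?_⟩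
  have hq' := cl_succ_of_mem hq
  have hq2 := (hQ.mem_iff q hq').1 hqZ
  have h5 := h3 q hq' hqZ
  have h6 := h3 _ (map_mem_cl P_mem_ops hq) (A.P_mem _ hqZ)
  refine ⟨?_, fun h => h6.2.1 ?_, fun h => h6.2.2 ?_⟩
  · exact (A.lt_S_iff hqZ h1 h4.2.1.symm h5.2.1).trans
      (h5.1.trans (A.lt_S_iff hq2 h2 h4.2.2.symm h5.2.2).symm)
  · simp only [Prod.map_fst] at h ⊢; rw [h, A.P_S]
  · simp only [Prod.map_snd] at h ⊢; rw [h, A.P_S]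

lemma lt_P_iff {x y : M} (hx : x ∈ A.Z) (hy : y ∈ A.Z) (hy1 : y ≠ A.c1)
    (hne : A.S x ≠ y) : x < A.P y ↔ x < y := by
  have h4 : A.P y ≠ A.c4 := fun h => hy1 (by rw [← A.S_P y, h, A.S_c4])
  have h6 : x ≠ A.P y := fun h => hne (by rw [h, A.S_P])
  have := A.lt_S_iff hx (A.P_mem _ hy) h4 h6
  rw [A.S_P] at this
  exact this.symm

lemma Cut.map_P (hc : A.consts ⊆ R) (hQ : A.PIso (A.cl R (n + 1)))
    (h : A.Cut (A.cl R (n + 1)) p) : A.Cut (A.cl R n) (Prod.map A.P A.P p) := by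
  obtain ⟨h1, h2, h3⟩ := h
  have h4 := h3 _ (subset_cl _ (hc c1_mem_consts)) A.c1_mem
  have h4' : (A.c4, A.c4) ∈ A.cl R (n + 1) := subset_cl _ (hc c4_mem_consts)
  refine ⟨A.P_mem _ h1, A.P_mem _ h2, fun q hq hqZ => ?_⟩
  have hq' := cl_succ_of_mem hq
  have hq2 := (hQ.mem_iff q hq').1 hqZ
  have h5 := h3 q hq' hqZ
  have h6 := h3 _ (map_mem_cl S_mem_ops hq) (A.S_mem _ hqZ)
  simp only [Prod.map_fst, Prod.map_snd] at h6 ⊢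
  refine ⟨?_, fun h => h6.2.1 (by rw [h, A.S_P]), fun h => h6.2.2 (by rw [h, A.S_P])⟩
  by_cases hq4 : q.1 = A.c4
  · have hq4' := (hQ.eq_iff hq' h4').1 hq4
    simp only at hq4'
    have e1 := A.le_c4 _ (A.P_mem _ h1)
    have e2 := A.le_c4 _ (A.P_mem _ h2)
    rw [hq4, hq4']
    exact iff_of_false (not_lt.2 e1) (not_lt.2 e2)
  · have hq4' : q.2 ≠ A.c4 := fun h => hq4 ((hQ.eq_iff hq' h4').2 h)
    rw [lt_P_iff hqZ h1 h4.2.1.symm h6.2.1, h5.1,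
      lt_P_iff hq2 h2 h4.2.2.symm h6.2.2]

/-- A comparison with `f a` becomes one of `g x` with `a` and one of `x` with a constant; both are
visible in a closure one round larger. -/
lemma lt_f_iff_of_le {x a : M} (hx : x ∈ A.Z) (ha : a ∈ A.Z) (h : a ≤ A.c2) :
    x < A.f a ↔ x < A.c3 ∨ A.g x < a := by
  have h1 := A.c3_le_f a ha h
  have h2 := A.P_c3_lt
  rcases lt_or_ge x A.c3 with h3 | h3
  · simp [h3, h3.trans_le h1]
  · have h4 := A.f_lt_f_low (A.g_mem x hx) ha (A.g_le hx h3) h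
    rw [A.f_g x (by order)] at h4
    simp [h4, h3.not_gt]

lemma lt_f_iff_of_lt {x a : M} (hx : x ∈ A.Z) (ha : a ∈ A.Z) (h : A.c2 < a) :
    x < A.f a ↔ x < A.P A.c3 ∧ A.g x < a := by
  have h1 := A.f_lt a ha h
  rcases lt_or_ge x (A.P A.c3) with h3 | h3
  · have h4 := A.f_lt_f_high (A.g_mem x hx) ha (A.lt_g hx h3) h
    rw [A.f_g x (by order)] at h4
    simp [h4, h3]
  · simp [h3.not_gt, (h1.trans_le h3).le]

lemma Cut.map_f (hc : A.consts ⊆ R) (hQ : A.PIso (A.cl R (n + 1)))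
    (h : A.Cut (A.cl R (n + 1)) p) : A.Cut (A.cl R n) (Prod.map A.f A.f p) := by
  obtain ⟨h1, h2, h3⟩ := h
  have k2 := h3 _ (subset_cl _ (hc c2_mem_consts)) A.c2_mem
  have k3 : (A.c3, A.c3) ∈ A.cl R (n + 1) := subset_cl _ (hc c3_mem_consts)
  have k4 : (A.P A.c3, A.P A.c3) ∈ A.cl R (n + 1) :=
    map_mem_cl (p := (A.c3, A.c3)) P_mem_ops (subset_cl _ (hc c3_mem_consts))
  refine ⟨A.f_mem _ h1, A.f_mem _ h2, fun q hq hqZ => ?_⟩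
  have hq' := cl_succ_of_mem hq
  have hq2 := (hQ.mem_iff q hq').1 hqZ
  have h6 := h3 _ (map_mem_cl g_mem_ops hq) (A.g_mem _ hqZ)
  simp only [Prod.map_fst, Prod.map_snd] at h6 k2 ⊢
  refine ⟨?_, fun h => h6.2.1 (by rw [h, A.g_f]), fun h => h6.2.2 (by rw [h, A.g_f])⟩
  rcases lt_or_ge A.c2 p.1 with h7 | h7
  · rw [lt_f_iff_of_lt hqZ h1 h7, lt_f_iff_of_lt hq2 h2 (k2.1.1 h7), h6.1,
      hQ.lt_iff q hq' _ k4]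
  · have h8 : p.2 ≤ A.c2 := not_lt.1 (mt k2.1.2 (not_lt.2 h7))
    rw [lt_f_iff_of_le hqZ h1 h7, lt_f_iff_of_le hq2 h2 h8, h6.1, hQ.lt_iff q hq' _ k3]

lemma lt_g_iff_of_le {x a : M} (hx : x ∈ A.Z) (ha : a ∈ A.Z) (h : A.c3 ≤ a) :
    x < A.g a ↔ x ≤ A.c2 ∧ A.f x < a := by
  have h1 := A.g_le ha h
  have h2 := A.P_c3_lt
  rcases le_or_gt x A.c2 with h3 | h3
  · have h4 := A.f_lt_f_low hx (A.g_mem a ha) h3 h1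
    rw [A.f_g a (by order)] at h4
    simp [h4, h3]
  · simp [h3.not_ge, (h1.trans_lt h3).le]

lemma lt_g_iff_of_lt {x a : M} (hx : x ∈ A.Z) (ha : a ∈ A.Z) (h : a < A.P A.c3) :
    x < A.g a ↔ x ≤ A.c2 ∨ A.f x < a := by
  have h1 := A.lt_g ha h
  rcases le_or_gt x A.c2 with h3 | h3
  · simp [h3, h3.trans_lt h1]
  · have h4 := A.f_lt_f_high hx (A.g_mem a ha) h3 h1
    rw [A.f_g a (by order)] at h4
    simp [h4, h3.not_ge]

lemma Cut.ne_P_c3 (hc : A.consts ⊆ R) (h : A.Cut (A.cl R (n + 1)) p) :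
    A.P A.c3 ≠ p.1 ∧ A.P A.c3 ≠ p.2 :=
  (h.2.2 _ (map_mem_cl (p := (A.c3, A.c3)) P_mem_ops (subset_cl _ (hc c3_mem_consts)))
    (A.P_mem _ A.c3_mem)).2

lemma Cut.ne_c4 (hc : A.consts ⊆ R) (h : A.Cut (A.cl R n) p) :
    p.1 ≠ A.c4 ∧ p.2 ≠ A.c4 :=
  ((h.2.2 _ (subset_cl _ (hc c4_mem_consts)) A.c4_mem).2).imp Ne.symm Ne.symm

lemma Cut.le_c2_iff (hc : A.consts ⊆ R) (h : A.Cut (A.cl R n) p) :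
    p.1 ≤ A.c2 ↔ p.2 ≤ A.c2 := by
  have := (h.2.2 _ (subset_cl _ (hc c2_mem_consts)) A.c2_mem).1
  simpa using not_congr this

/-- The identity `f (g x) = x` fails only at `P c3`, which lies in the closure after one round, so a
cut avoids it. -/
lemma Cut.map_g (hc : A.consts ⊆ R) (hQ : A.PIso (A.cl R (n + 1)))
    (h : A.Cut (A.cl R (n + 1)) p) : A.Cut (A.cl R n) (Prod.map A.g A.g p) := by
  have hp := h.ne_P_c3 hc
  obtain ⟨h1, h2, h3⟩ := h
  have k2 : (A.c2, A.c2) ∈ A.cl R (n + 1) := subset_cl _ (hc c2_mem_consts)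
  have k4 := h3 _ (map_mem_cl (p := (A.c3, A.c3)) P_mem_ops (subset_cl _ (hc c3_mem_consts)))
    (A.P_mem _ A.c3_mem)
  refine ⟨A.g_mem _ h1, A.g_mem _ h2, fun q hq hqZ => ?_⟩
  have hq' := cl_succ_of_mem hq
  have hq2 := (hQ.mem_iff q hq').1 hqZ
  have h6 := h3 _ (map_mem_cl f_mem_ops hq) (A.f_mem _ hqZ)
  simp only [Prod.map_fst, Prod.map_snd] at h6 k4 ⊢
  refine ⟨?_, fun h => h6.2.1 (by rw [h, A.f_g _ hp.1.symm]),
    fun h => h6.2.2 (by rw [h, A.f_g _ hp.2.symm])⟩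
  have hle : q.1 ≤ A.c2 ↔ q.2 ≤ A.c2 := by
    simpa using not_congr (hQ.lt_iff _ k2 q hq')
  rcases A.lt_P_c3_or h1 with h7 | h7 | h7
  · have h8 : p.2 < A.P A.c3 := lt_of_le_of_ne
      (not_lt.1 (mt k4.1.2 (not_lt.2 h7.le))) hp.2.symm
    rw [lt_g_iff_of_lt hqZ h1 h7, lt_g_iff_of_lt hq2 h2 h8, h6.1, hle]
  · exact absurd h7.symm hp.1
  · have h8 : A.c3 ≤ p.2 := by
      have h9 := k4.1.1 (A.P_c3_lt.trans_le h7)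
      rcases A.lt_P_c3_or h2 with h | h | h
      · exact absurd h h9.not_gt
      · exact absurd h.symm hp.2
      · exact h
    rw [lt_g_iff_of_le hqZ h1 h7, lt_g_iff_of_le hq2 h2 h8, h6.1, hle]

lemma Cut.map (hc : A.consts ⊆ R) (hQ : A.PIso (A.cl R (n + 1)))
    (h : A.Cut (A.cl R (n + 1)) p) {o : M → M} (ho : o ∈ A.ops) :
    A.Cut (A.cl R n) (Prod.map o o p) := by
  simp only [ops, Set.mem_insert_iff, Set.mem_singleton_iff] at ho
  rcases ho with rfl | rfl | rfl | rfl | rfl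
  · exact h.map_S hc hQ
  · exact h.map_P hc hQ
  · have : Prod.map A.proj A.proj p = p :=
      Prod.ext (A.proj_of_mem _ h.1) (A.proj_of_mem _ h.2.1)
    rw [this]
    exact h.mono (cl_mono (Nat.le_succ n))
  · exact h.map_f hc hQ
  · exact h.map_g hc hQ

end CutSteps

lemma Cut.iterate (hc : A.consts ⊆ R) {o : M → M} (ho : o ∈ A.ops) {p : M × M} (k : ℕ) :
    ∀ {n : ℕ}, A.PIso (A.cl R (n + k)) → A.Cut (A.cl R (n + k)) p →
    A.Cut (A.cl R n) ((Prod.map o o)^[k] p) := by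
  induction k with
  | zero => exact fun _ h => h
  | succ k ih =>
    intro n hQ h
    rw [Function.iterate_succ_apply']
    refine Cut.map hc (hQ.mono (cl_mono (by omega))) (ih (n := n + 1) ?_ ?_) ho
    · exact hQ.mono (cl_mono (by omega))
    · exact h.mono (cl_mono (by omega))

lemma Cut.of_mem_cl (hc : A.consts ⊆ R) {p : M × M} {r : ℕ} : ∀ {n : ℕ}, A.PIso (A.cl R (n + r)) →
    A.Cut (A.cl R (n + r)) p → ∀ q ∈ A.cl {p} r, A.Cut (A.cl R n) q := by
  induction r with
  | zero => rintro n - h q rfl; exact h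
  | succ r ih =>
    rintro n hQ h q (hq | ⟨o, ho, q, hq, rfl⟩)
    · exact ih (hQ.mono (cl_mono (by omega))) (h.mono (cl_mono (by omega))) q hq
    · refine Cut.map hc (hQ.mono (cl_mono (by omega))) (ih (n := n + 1) ?_ ?_ q hq) ho
      · exact hQ.mono (cl_mono (by omega))
      · exact h.mono (cl_mono (by omega))

/-! ### The orbit of one new pair -/

omit [LinearOrder M] in
lemma iterate_map_fst (h : M → M) (n : ℕ) (p : M × M) : ((Prod.map h h)^[n] p).1 = h^[n] p.1 := by
  rw [Prod.map_iterate]; rfl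

omit [LinearOrder M] in
lemma iterate_map_snd (h : M → M) (n : ℕ) (p : M × M) : ((Prod.map h h)^[n] p).2 = h^[n] p.2 := by
  rw [Prod.map_iterate]; rfl

/-- The iterates of `p` under `f` still fill cuts of a closure containing `c4`, so they avoid the
only point where `f` and `S` fail to commute. -/
lemma Cut.iterate_f_S (hc : A.consts ⊆ R) {p : M × M} {n : ℕ} (hQ : A.PIso (A.cl R n))
    (h : A.Cut (A.cl R n) p) : (Prod.map A.f A.f)^[n] (Prod.map A.S A.S p) =
      Prod.map A.S A.S ((Prod.map A.f A.f)^[n] p) := by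
  induction n with
  | zero => rfl
  | succ n ih =>
    have h1 : A.Cut (A.cl R 1) ((Prod.map A.f A.f)^[n] p) :=
      Cut.iterate hc f_mem_ops n (hQ.mono (cl_mono (by omega))) (h.mono (cl_mono (by omega)))
    rw [Function.iterate_succ_apply', ih (hQ.mono (cl_mono (by omega)))
      (h.mono (cl_mono (by omega))), Function.iterate_succ_apply']
    exact Prod.ext (A.f_S _ (h1.ne_c4 hc).1) (A.f_S _ (h1.ne_c4 hc).2)

lemma Cut.iterate_f_iterate_S (hc : A.consts ⊆ R) {p : M × M} {n k : ℕ}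
    (hQ : A.PIso (A.cl R (n + k))) (h : A.Cut (A.cl R (n + k)) p) :
    (Prod.map A.f A.f)^[n] ((Prod.map A.S A.S)^[k] p) =
      (Prod.map A.S A.S)^[k] ((Prod.map A.f A.f)^[n] p) := by
  induction k with
  | zero => rfl
  | succ k ih =>
    have h1 : A.Cut (A.cl R n) ((Prod.map A.S A.S)^[k] p) :=
      Cut.iterate hc S_mem_ops k (hQ.mono (cl_mono (by omega))) (h.mono (cl_mono (by omega)))
    rw [Function.iterate_succ_apply', h1.iterate_f_S hc (hQ.mono (cl_mono (by omega))),
      ih (hQ.mono (cl_mono (by omega))) (h.mono (cl_mono (by omega))),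
      Function.iterate_succ_apply']

lemma iterate_S_lt_iterate_S_f {z : M} (hz : z ∈ A.Z) {d k l : ℕ} (hd : 0 < d)
    (hk : ∀ i < k, A.S^[i] z ≠ A.c4) (hl : ∀ i < l, A.S^[i] (A.f^[d] z) ≠ A.c4) :
    A.S^[k] z < A.S^[l] (A.f^[d] z) ↔ ∃ e < d, A.f^[e] z ≤ A.c2 := by
  rw [A.iterate_S_lt_iff hz (A.iterate_mem A.f_mem hz d) k l hk hl
    fun i j => (A.far d hd z hz j i).symm, A.lt_iterate_f_iff hz hd]

/-- Moving `S` outside and setting `γ = fⁿ β`, one compares `S^[k] γ` with `S^[l] (f^[d] γ)`. For `d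
= 0` the exponents decide. For `d > 0` the `S`-orbits differ, so `k` and `l` drop out, and it only
matters which `f^[e] γ` with `e < d` lie at or below `c2`; this agrees in both components. -/
lemma Cut.lt_iff_of_le (hc : A.consts ⊆ R) {β : M × M} {n m k l N : ℕ} (hnm : n ≤ m)
    (hN : n + m + k + l + 1 ≤ N) (hQ : A.PIso (A.cl R N)) (h : A.Cut (A.cl R N) β)
    {p q : M × M} (hp : p = (Prod.map A.f A.f)^[n] ((Prod.map A.S A.S)^[k] β))
    (hq : q = (Prod.map A.f A.f)^[m] ((Prod.map A.S A.S)^[l] β)) :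
    (p.1 < q.1 ↔ p.2 < q.2) ∧ (q.1 < p.1 ↔ q.2 < p.2) := by
  obtain ⟨d, rfl⟩ := Nat.exists_eq_add_of_le' hnm
  rw [Cut.iterate_f_iterate_S hc (hQ.mono (cl_mono (by omega))) (h.mono (cl_mono (by omega)))]
    at hp hq
  rw [Function.iterate_add_apply] at hq
  have hγ : A.Cut (A.cl R (d + k + l + 1)) ((Prod.map A.f A.f)^[n] β) :=
    Cut.iterate hc f_mem_ops n (hQ.mono (cl_mono (by omega))) (h.mono (cl_mono (by omega)))
  set γ := (Prod.map A.f A.f)^[n] β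
  have hQ' : A.PIso (A.cl R (d + k + l + 1)) := hQ.mono (cl_mono (by omega))
  clear_value γ
  have hS : ∀ i < k + l + 1, A.S^[i] γ.1 ≠ A.c4 ∧ A.S^[i] γ.2 ≠ A.c4 := by
    intro i hi
    have h1 : A.Cut (A.cl R 0) ((Prod.map A.S A.S)^[i] γ) :=
      Cut.iterate hc S_mem_ops i (hQ'.mono (cl_mono (by omega))) (hγ.mono (cl_mono (by omega)))
    have := h1.ne_c4 hc
    rwa [iterate_map_fst, iterate_map_snd] at this
  have hS' : ∀ i < k + l + 1, A.S^[i] (A.f^[d] γ.1) ≠ A.c4 ∧ A.S^[i] (A.f^[d] γ.2) ≠ A.c4 := by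
    intro i hi
    have h1 : A.Cut (A.cl R i) ((Prod.map A.f A.f)^[d] γ) :=
      Cut.iterate hc f_mem_ops d (hQ'.mono (cl_mono (by omega))) (hγ.mono (cl_mono (by omega)))
    have h2 : A.Cut (A.cl R 0) ((Prod.map A.S A.S)^[i] ((Prod.map A.f A.f)^[d] γ)) :=
      Cut.iterate hc S_mem_ops i (hQ'.mono (cl_mono (by omega))) (h1.mono (cl_mono (by omega)))
    have := h2.ne_c4 hc
    rwa [iterate_map_fst, iterate_map_snd, iterate_map_fst, iterate_map_snd] at this
  have hp1 : p.1 = A.S^[k] γ.1 := by rw [hp, iterate_map_fst]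
  have hp2 : p.2 = A.S^[k] γ.2 := by rw [hp, iterate_map_snd]
  have hq1 : q.1 = A.S^[l] (A.f^[d] γ.1) := by rw [hq, iterate_map_fst, iterate_map_fst]
  have hq2 : q.2 = A.S^[l] (A.f^[d] γ.2) := by rw [hq, iterate_map_snd, iterate_map_snd]
  rw [hp1, hp2, hq1, hq2]
  rcases Nat.eq_zero_or_pos d with rfl | hd
  · simp only [Function.iterate_zero_apply]
    have e1 := fun i j hi hj => A.iterate_S_lt_iterate_S_iff hγ.1 (k := i) (l := j)
      (n := k + l + 1) hi hj fun i hi => (hS i hi).1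
    have e2 := fun i j hi hj => A.iterate_S_lt_iterate_S_iff hγ.2.1 (k := i) (l := j)
      (n := k + l + 1) hi hj fun i hi => (hS i hi).2
    rw [e1 k l (by omega) (by omega), e2 k l (by omega) (by omega), e1 l k (by omega) (by omega),
      e2 l k (by omega) (by omega)]
    exact ⟨Iff.rfl, Iff.rfl⟩
  · have hlt : A.S^[k] γ.1 < A.S^[l] (A.f^[d] γ.1) ↔ A.S^[k] γ.2 < A.S^[l] (A.f^[d] γ.2) := by
      rw [iterate_S_lt_iterate_S_f hγ.1 hd (fun i hi => (hS i (by omega)).1)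
          fun i hi => (hS' i (by omega)).1,
        iterate_S_lt_iterate_S_f hγ.2.1 hd (fun i hi => (hS i (by omega)).2)
          fun i hi => (hS' i (by omega)).2]
      refine exists_congr fun e => and_congr_right fun he => ?_
      have h1 : A.Cut (A.cl R 0) ((Prod.map A.f A.f)^[e] γ) :=
        Cut.iterate hc f_mem_ops e (hQ'.mono (cl_mono (by omega))) (hγ.mono (cl_mono (by omega)))
      have := h1.le_c2_iff hc
      rwa [iterate_map_fst, iterate_map_snd] at this
    refine ⟨hlt, ?_⟩
    have n1 := A.far d hd _ hγ.1 l k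
    have n2 := A.far d hd _ hγ.2.1 l k
    have := not_congr hlt
    rw [not_lt, not_lt] at this
    rw [n1.le_iff_lt, n2.le_iff_lt] at this
    exact this

/-- Starting with both exponents equal to `r` leaves room for `r` applications of `g` and `P`, each
of which lowers an exponent by one. -/
lemma Cut.exists_eq_iterate (hc : A.consts ⊆ R) {β : M × M} {r N : ℕ} (hN : 4 * r + 1 ≤ N)
    (hQ : A.PIso (A.cl R N)) (h : A.Cut (A.cl R N) β) {j : ℕ} (hj : j ≤ r) :
    ∀ q ∈ A.cl {(Prod.map A.f A.f)^[r] ((Prod.map A.S A.S)^[r] β)} j, ∃ n k,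
      r - j ≤ n ∧ n ≤ r + j ∧ r - j ≤ k ∧ k ≤ r + j ∧ q = (Prod.map A.f A.f)^[n] ((Prod.map A.S A.S)^[k] β) := by
  induction j with
  | zero =>
    rintro q rfl
    exact ⟨r, r, by simp⟩
  | succ j ih =>
    rintro q (hq | ⟨o, ho, q, hq, rfl⟩)
    · obtain ⟨n, k, h1, h2, h3, h4, h5⟩ := ih (by omega) q hq
      exact ⟨n, k, by omega, by omega, by omega, by omega, h5⟩
    · obtain ⟨n, k, h1, h2, h3, h4, rfl⟩ := ih (by omega) q hq
      have hcomm : ∀ k ≤ r + j + 1, (Prod.map A.f A.f)^[n] ((Prod.map A.S A.S)^[k] β) =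
          (Prod.map A.S A.S)^[k] ((Prod.map A.f A.f)^[n] β) := fun k hk =>
        Cut.iterate_f_iterate_S hc (hQ.mono (cl_mono (by omega))) (h.mono (cl_mono (by omega)))
      simp only [ops, Set.mem_insert_iff, Set.mem_singleton_iff] at ho
      rcases ho with rfl | rfl | rfl | rfl | rfl
      · refine ⟨n, k + 1, by omega, by omega, by omega, by omega, ?_⟩
        rw [hcomm k (by omega), hcomm (k + 1) (by omega), Function.iterate_succ_apply']
      · refine ⟨n, k - 1, by omega, by omega, by omega, by omega, ?_⟩
        obtain ⟨k, rfl⟩ : ∃ k', k = k' + 1 := ⟨k - 1, by omega⟩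
        rw [hcomm _ (by omega), hcomm _ (by omega), Function.iterate_succ_apply',
          Nat.add_sub_cancel]
        exact Prod.ext (A.P_S _) (A.P_S _)
      · refine ⟨n, k, by omega, by omega, by omega, by omega, ?_⟩
        have e1 : A.Cut (A.cl R n) ((Prod.map A.S A.S)^[k] β) :=
          Cut.iterate hc S_mem_ops k (hQ.mono (cl_mono (by omega))) (h.mono (cl_mono (by omega)))
        have e2 : A.Cut (A.cl R 0) ((Prod.map A.f A.f)^[n] ((Prod.map A.S A.S)^[k] β)) :=
          Cut.iterate hc f_mem_ops n (hQ.mono (cl_mono (by omega))) (e1.mono (cl_mono (by omega)))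
        exact Prod.ext (A.proj_of_mem _ e2.1) (A.proj_of_mem _ e2.2.1)
      · refine ⟨n + 1, k, by omega, by omega, by omega, by omega, ?_⟩
        rw [Function.iterate_succ_apply']
      · refine ⟨n - 1, k, by omega, by omega, by omega, by omega, ?_⟩
        obtain ⟨n, rfl⟩ : ∃ n', n = n' + 1 := ⟨n - 1, by omega⟩
        rw [Function.iterate_succ_apply', Nat.add_sub_cancel]
        exact Prod.ext (A.g_f _) (A.g_f _)

lemma Cut.iterate_f_iterate_g (hc : A.consts ⊆ R) {p : M × M} {r : ℕ}
    (hQ : A.PIso (A.cl R r)) (h : A.Cut (A.cl R r) p) :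
    (Prod.map A.f A.f)^[r] ((Prod.map A.g A.g)^[r] p) = p := by
  induction r with
  | zero => rfl
  | succ r ih =>
    have h1 : A.Cut (A.cl R 1) ((Prod.map A.g A.g)^[r] p) :=
      Cut.iterate hc g_mem_ops r (hQ.mono (cl_mono (by omega))) (h.mono (cl_mono (by omega)))
    have h2 := h1.ne_P_c3 hc
    rw [Function.iterate_succ_apply, Function.iterate_succ_apply']
    have h3 : Prod.map A.f A.f (Prod.map A.g A.g ((Prod.map A.g A.g)^[r] p)) =
        (Prod.map A.g A.g)^[r] p := Prod.ext (A.f_g _ h2.1.symm) (A.f_g _ h2.2.symm)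
    rw [h3]
    exact ih (hQ.mono (cl_mono (by omega))) (h.mono (cl_mono (by omega)))

/-- The depth `10 * r + 1` pays for `r` rounds of `g` and `r` of `P` to reach `β`, and then for four
exponents of size at most `2 * r` when two points are compared. -/
lemma Cut.pIso_cl_singleton (hc : A.consts ⊆ R) {p : M × M} {r N : ℕ} (hN : 10 * r + 1 ≤ N)
    (hQ : A.PIso (A.cl R N)) (h : A.Cut (A.cl R N) p) : A.PIso (A.cl {p} r) := by
  refine ⟨?_, fun q hq => ?_⟩
  · let α := (Prod.map A.g A.g)^[r] p
    let β := (Prod.map A.P A.P)^[r] α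
    have hα : A.Cut (A.cl R (9 * r + 1)) α :=
      Cut.iterate hc g_mem_ops r (hQ.mono (cl_mono (by omega))) (h.mono (cl_mono (by omega)))
    have hβ : A.Cut (A.cl R (8 * r + 1)) β :=
      Cut.iterate hc P_mem_ops r (hQ.mono (cl_mono (by omega))) (hα.mono (cl_mono (by omega)))
    have e1 : (Prod.map A.S A.S)^[r] β = α := by
      have : Function.RightInverse (Prod.map A.P A.P) (Prod.map A.S A.S) :=
        fun x => Prod.ext (A.S_P _) (A.S_P _)
      exact this.iterate r α
    have e2 : (Prod.map A.f A.f)^[r] ((Prod.map A.S A.S)^[r] β) = p := by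
      rw [e1]
      exact Cut.iterate_f_iterate_g hc (hQ.mono (cl_mono (by omega))) (h.mono (cl_mono (by omega)))
    have hQ' : A.PIso (A.cl R (8 * r + 1)) := hQ.mono (cl_mono (by omega))
    rw [← e2]
    intro q hq q' hq'
    obtain ⟨n, k, h1, h2, h3, h4, h5⟩ :=
      Cut.exists_eq_iterate hc (by omega) hQ' hβ le_rfl q hq
    obtain ⟨m, l, h1', h2', h3', h4', h5'⟩ :=
      Cut.exists_eq_iterate hc (by omega) hQ' hβ le_rfl q' hq'
    rcases le_total n m with hnm | hnm
    · exact (Cut.lt_iff_of_le hc hnm (by omega) hQ' hβ h5 h5').1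
    · exact (Cut.lt_iff_of_le hc hnm (by omega) hQ' hβ h5' h5).2
  · have := Cut.of_mem_cl (n := 0) hc (hQ.mono (cl_mono (by omega))) (h.mono (cl_mono (by omega)))
      q hq
    exact iff_of_true this.1 this.2.1

/-! ### Extending a partial isomorphism by one pair -/

lemma lt_iff_proj {x z : M} (hx : x ∉ A.Z) (hz : z ∈ A.Z) :
    x < z ↔ x < A.c4 ∧ A.proj x ≤ z := by
  have h1 := A.le_c4 z hz
  constructor
  · exact fun h => ⟨h.trans_le h1, A.proj_le x z hz h.le⟩
  · rintro ⟨h2, h3⟩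
    exact lt_of_le_of_ne ((A.le_proj x h2.le).trans h3) fun h => hx (h ▸ hz)

/-- A pair filling the same cut of a large closure extends the partial isomorphism. -/
lemma Cut.pIso_cl_insert (hc : A.consts ⊆ R) {p : M × M} {r N : ℕ} (hN : 10 * r + 1 ≤ N)
    (hQ : A.PIso (A.cl R N)) (h : A.Cut (A.cl R N) p) : A.PIso (A.cl (insert p R) r) := by
  have hW := Cut.pIso_cl_singleton hc hN hQ h
  have hR : A.PIso (A.cl R r) := hQ.mono (cl_mono (by omega))
  refine PIso.mono (Q := A.cl R r ∪ A.cl {p} r) ?_ cl_insert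
  have hcut : ∀ q ∈ A.cl {p} r, A.Cut (A.cl R (r + 1)) q :=
    Cut.of_mem_cl hc (hQ.mono (cl_mono (by omega))) (h.mono (cl_mono (by omega)))
  have mixed : ∀ x ∈ A.cl R r, ∀ q ∈ A.cl {p} r, (x.1 < q.1 ↔ x.2 < q.2) ∧
      x.1 ≠ q.1 ∧ x.2 ≠ q.2 := by
    intro x hx q hq
    have hC := hcut q hq
    by_cases hxZ : x.1 ∈ A.Z
    · exact hC.2.2 x (cl_succ_of_mem hx) hxZ
    -- Cuts only speak of points of `Z`, so `x` is replaced by its projection, at the cost of one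
    -- more round.
    · have hxZ2 : x.2 ∉ A.Z := mt (hR.mem_iff x hx).2 hxZ
      have h4 := hR.lt_iff x hx _ (subset_cl _ (hc c4_mem_consts))
      have h5 := hC.2.2 _ (map_mem_cl proj_mem_ops hx) (A.proj_mem _)
      simp only [Prod.map_fst, Prod.map_snd] at h5
      refine ⟨?_, fun h => hxZ (h ▸ hC.1), fun h => hxZ2 (h ▸ hC.2.1)⟩
      rw [lt_iff_proj hxZ hC.1, lt_iff_proj hxZ2 hC.2.1, h4, h5.2.1.le_iff_lt, h5.2.2.le_iff_lt,
        h5.1]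
  refine ⟨?_, ?_⟩
  · rintro x (hx | hx) y (hy | hy)
    · exact hR.lt_iff x hx y hy
    · exact (mixed x hx y hy).1
    · obtain ⟨h1, h2, h3⟩ := mixed y hy x hx
      have := not_congr h1
      rwa [not_lt, not_lt, h2.symm.le_iff_lt, h3.symm.le_iff_lt] at this
    · exact hW.lt_iff x hx y hy
  · rintro x (hx | hx)
    · exact hR.mem_iff x hx
    · exact hW.mem_iff x hx

/-- Off `Z` every operation except `proj` is the identity, and the projected pair is already in `R`.
-/
lemma cl_insert_of_notMem {p : M × M} {r : ℕ} (h1 : p.1 ∉ A.Z) (h2 : p.2 ∉ A.Z)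
    (hp : Prod.map A.proj A.proj p ∈ R) : A.cl (insert p R) r ⊆ insert p (A.cl R r) := by
  induction r with
  | zero => exact subset_rfl
  | succ r ih =>
    rintro q (hq | ⟨o, ho, q, hq, rfl⟩)
    · exact (ih hq).imp id cl_succ_of_mem
    · rcases ih hq with rfl | hq
      · simp only [ops, Set.mem_insert_iff, Set.mem_singleton_iff] at ho
        rcases ho with rfl | rfl | rfl | rfl | rfl
        · exact .inl (Prod.ext (A.S_off _ h1) (A.S_off _ h2))
        · exact .inl (Prod.ext (A.P_off h1) (A.P_off h2))
        · exact .inr (subset_cl _ hp)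
        · exact .inl (Prod.ext (A.f_off _ h1) (A.f_off _ h2))
        · exact .inl (Prod.ext (A.g_off _ h1) (A.g_off _ h2))
      · exact .inr (map_mem_cl ho hq)

/-- Adding a pair of points outside of `Z` to a partial isomorphism. -/
lemma PIso.insert_of_notMem {p : M × M} {r : ℕ} (hQ : A.PIso (A.cl R r))
    (h1 : p.1 ∉ A.Z) (h2 : p.2 ∉ A.Z) (hp : Prod.map A.proj A.proj p ∈ R)
    (h : ∀ q ∈ A.cl R r, (q.1 < p.1 ↔ q.2 < p.2) ∧ (p.1 < q.1 ↔ p.2 < q.2)) :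
    A.PIso (A.cl (insert p R) r) := by
  refine PIso.mono (Q := insert p (A.cl R r)) ?_ (cl_insert_of_notMem h1 h2 hp)
  refine ⟨?_, ?_⟩
  · rintro x (rfl | hx) y (rfl | hy)
    · simp
    · exact (h y hy).2
    · exact (h x hx).1
    · exact hQ.lt_iff x hx y hy
  · rintro x (rfl | hx)
    · exact iff_of_false h1 h2
    · exact hQ.mem_iff x hx

lemma pIso_cl_insert_of_mem {p : M × M} {r N : ℕ} (hQ : A.PIso (A.cl R (N + r)))
    (hR : R ⊆ A.cl R N) (hp : p ∈ A.cl R N) : A.PIso (A.cl (insert p R) r) :=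
  hQ.mono (cl_subset_cl (Set.insert_subset hp hR))

/-! ### Back and forth -/

lemma exists_cut (hc : A.consts ⊆ R) (hfin : R.Finite) {N : ℕ} (hQ : A.PIso (A.cl R (N + 1)))
    {a : M} (ha : a ∈ A.Z) (hne : ∀ q ∈ A.cl R N, q.1 ≠ a) : ∃ b, A.Cut (A.cl R N) (a, b) := by
  have hQN : A.PIso (A.cl R N) := hQ.mono (cl_mono (by omega))
  have hf := cl_finite (A := A) hfin N
  have k1 : (A.c1, A.c1) ∈ A.cl R N := subset_cl _ (hc c1_mem_consts)
  have k4 : (A.c4, A.c4) ∈ A.cl R N := subset_cl _ (hc c4_mem_consts)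
  obtain ⟨s, ⟨hs, hsZ, hsa⟩, hsmax⟩ := (hf.subset (Set.sep_subset _
    fun q => q.1 ∈ A.Z ∧ q.1 < a)).exists_maximalFor Prod.fst _
    ⟨(A.c1, A.c1), k1, A.c1_mem, lt_of_le_of_ne (A.c1_le a ha) (hne _ k1)⟩
  obtain ⟨t, ⟨ht, htZ, hat⟩, htmin⟩ := (hf.subset (Set.sep_subset _
    fun q => q.1 ∈ A.Z ∧ a < q.1)).exists_minimalFor Prod.fst _
    ⟨(A.c4, A.c4), k4, A.c4_mem, lt_of_le_of_ne (A.le_c4 a ha) (hne _ k4).symm⟩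
  have hs2 := (hQN.mem_iff s hs).1 hsZ
  have ht2 := (hQN.mem_iff t ht).1 htZ
  have h1 : A.S s.1 < t.1 := (A.S_le _ hsZ _ ha hsa).trans_lt hat
  have h2 : A.S s.2 < t.2 := (hQ.lt_iff _ (map_mem_cl S_mem_ops hs) t (cl_succ_of_mem ht)).1 h1
  have h3 : s.2 < t.2 := (hQN.lt_iff s hs t ht).1 (hsa.trans hat)
  have h4 : s.2 < A.S s.2 := A.lt_S _ hs2 (h3.trans_le (A.le_c4 _ ht2)).ne
  -- The gap around `a` is nonempty on the left, as `S s.1 ≤ a < t.1`. The extra round transports `S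
  -- s.1 < t.1` to `S s.2 < t.2`, so `S s.2` lies strictly inside the corresponding gap.
  refine ⟨A.S s.2, ha, A.S_mem _ hs2, fun q hq hqZ => ?_⟩
  have hq2 := (hQN.mem_iff q hq).1 hqZ
  rcases lt_or_gt_of_ne (hne q hq) with h | h
  · have e1 : q.1 ≤ s.1 := by
      by_contra! h'
      exact h'.not_ge (hsmax ⟨hq, hqZ, h⟩ h'.le)
    have e2 : q.2 ≤ s.2 := not_lt.1 (mt (hQN.lt_iff s hs q hq).2 (not_lt.2 e1))
    exact ⟨iff_of_true h (e2.trans_lt h4), h.ne, (e2.trans_lt h4).ne⟩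
  · have e1 : t.1 ≤ q.1 := by
      by_contra! h'
      exact h'.not_ge (htmin ⟨hq, hqZ, h⟩ h'.le)
    have e2 : t.2 ≤ q.2 := not_lt.1 (mt (hQN.lt_iff q hq t ht).2 (not_lt.2 e1))
    have e3 := h2.trans_le e2
    exact ⟨iff_of_false h.not_gt e3.not_gt, h.ne', e3.ne'⟩

/-- If `a` already occurs at depth `10 * r + 1`, its partner there serves, needing `r` more rounds;
otherwise a cut at that depth is filled, needing one more. -/
lemma exists_insert_of_mem (hc : A.consts ⊆ R) (hfin : R.Finite) {r : ℕ}
    (hQ : A.PIso (A.cl R (11 * r + 2))) {a : M} (ha : a ∈ A.Z) :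
    ∃ b, A.PIso (A.cl (insert (a, b) R) r) := by
  by_cases h : ∃ q ∈ A.cl R (10 * r + 1), q.1 = a
  · obtain ⟨⟨_, b⟩, hq, rfl⟩ := h
    exact ⟨b, pIso_cl_insert_of_mem (hQ.mono (cl_mono (by omega))) (subset_cl _) hq⟩
  · push Not at h
    obtain ⟨b, hb⟩ := exists_cut hc hfin (hQ.mono (cl_mono (by omega))) ha h
    exact ⟨b, Cut.pIso_cl_insert hc le_rfl (hQ.mono (cl_mono (by omega))) hb⟩

lemma exists_insert_of_notMem [DenselyOrdered M] [NoMinOrder M] [NoMaxOrder M]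
    (hc : A.consts ⊆ R) (hfin : R.Finite) {r : ℕ}
    (hQ : A.PIso (A.cl R (2 * r + 1))) {a : M} (ha : a ∉ A.Z) {b₀ : M} (hb₀ : (A.proj a, b₀) ∈ R) :
    ∃ b, A.PIso (A.cl (insert (a, b) R) r) := by
  by_cases h : ∃ q ∈ A.cl R (r + 1), q.1 = a
  · obtain ⟨⟨_, b⟩, hq, rfl⟩ := h
    exact ⟨b, pIso_cl_insert_of_mem (hQ.mono (cl_mono (by omega))) (subset_cl _) hq⟩
  push Not at h
  have hQ1 : A.PIso (A.cl R (r + 1)) := hQ.mono (cl_mono (by omega))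
  have hf := cl_finite (A := A) hfin (r + 1)
  have : Nonempty M := ⟨a⟩
  obtain ⟨b, hlo, hhi⟩ := Order.exists_between_finsets
    ((hf.subset (Set.sep_subset _ fun q => q.1 < a)).toFinset.image Prod.snd)
    ((hf.subset (Set.sep_subset _ fun q => a < q.1)).toFinset.image Prod.snd) (by
      simp only [Finset.mem_image, Set.Finite.mem_toFinset]
      rintro _ ⟨x, ⟨hx, hxa⟩, rfl⟩ _ ⟨y, ⟨hy, hya⟩, rfl⟩
      exact (hQ1.lt_iff x hx y hy).1 (hxa.trans hya))
  have hlo' : ∀ q ∈ A.cl R (r + 1), q.1 < a → q.2 < b := fun q hq hqa =>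
    hlo _ (Finset.mem_image_of_mem _ ((Set.Finite.mem_toFinset _).2 ⟨hq, hqa⟩))
  have hhi' : ∀ q ∈ A.cl R (r + 1), a < q.1 → b < q.2 := fun q hq hqa =>
    hhi _ (Finset.mem_image_of_mem _ ((Set.Finite.mem_toFinset _).2 ⟨hq, hqa⟩))
  have k1 : (A.c1, A.c1) ∈ A.cl R (r + 1) := subset_cl _ (hc c1_mem_consts)
  have k4 : (A.c4, A.c4) ∈ A.cl R (r + 1) := subset_cl _ (hc c4_mem_consts)
  have k0 : (A.proj a, b₀) ∈ A.cl R (r + 1) := subset_cl _ hb₀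
  have hb0Z : b₀ ∈ A.Z := (hQ1.mem_iff _ k0).1 (A.proj_mem a)
  -- The position of `a` relative to `c1`, `c4`, `P (proj a)` and `proj a` is copied to `b`. Below
  -- `c1` or above `c4` the projection is `c1`; otherwise `b` falls strictly between `P b₀` and
  -- `b₀`, consecutive in `Z`.
  have hb : b ∉ A.Z ∧ A.proj b = b₀ := by
    rcases lt_or_gt_of_ne (h _ k1) with h1 | h1
    · rcases lt_or_gt_of_ne (h _ k4) with h4 | h4
      · have e1 := hlo' _ k4 h4
        refine ⟨fun hb => (A.le_c4 b hb).not_gt e1, ?_⟩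
        rw [A.proj_gt b e1]
        exact (hQ1.eq_iff k1 k0).1 (A.proj_gt a h4).symm
      · have e1 : a < A.proj a := lt_of_le_of_ne (A.le_proj a h4.le) fun e => ha (e ▸ A.proj_mem a)
        have e2 : b < b₀ := hhi' _ k0 e1
        have e3 : A.P (A.proj a) < a := by
          by_contra! e4
          have e5 := A.proj_le a _ (A.P_mem _ (A.proj_mem a)) e4
          have e6 : A.P (A.proj a) ≠ A.c4 := by
            intro e7
            have e8 := A.S_P (A.proj a)
            rw [e7, A.S_c4] at e8
            rw [← e8] at e1
            exact lt_asymm h1 e1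
          have e7 := A.lt_S _ (A.P_mem _ (A.proj_mem a)) e6
          rw [A.S_P] at e7
          exact e7.not_ge e5
        have e4 : A.P b₀ < b := hlo' _ (map_mem_cl P_mem_ops (subset_cl r hb₀)) e3
        have e5 : ∀ z ∈ A.Z, b ≤ z → b₀ ≤ z := by
          intro z hz hbz
          have := A.S_le _ (A.P_mem _ hb0Z) z hz (e4.trans_le hbz)
          rwa [A.S_P] at this
        refine ⟨fun hb => (e5 b hb le_rfl).not_gt e2, ?_⟩
        exact (A.proj_le b _ hb0Z e2.le).antisymm
          (e5 _ (A.proj_mem b) (A.le_proj b (e2.le.trans (A.le_c4 _ hb0Z))))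
    · have e1 := hhi' _ k1 h1
      refine ⟨fun hb => (A.c1_le b hb).not_gt e1, ?_⟩
      have e3 : ∀ x, x < A.c1 → A.proj x = A.c1 := fun x hx =>
        (A.proj_le x _ A.c1_mem hx.le).antisymm (A.c1_le _ (A.proj_mem x))
      rw [e3 b e1]
      exact (hQ1.eq_iff k1 k0).1 (e3 a h1).symm
  refine ⟨b, PIso.insert_of_notMem (hQ.mono (cl_mono (by omega))) ha hb.1 ?_ fun q hq => ?_⟩
  · rw [Prod.map_apply, hb.2]; exact hb₀
  · have hq' := cl_succ_of_mem hq
    rcases lt_or_gt_of_ne (h q hq') with e | e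
    · exact ⟨iff_of_true e (hlo' q hq' e), iff_of_false e.not_gt (hlo' q hq' e).not_gt⟩
    · exact ⟨iff_of_false e.not_gt (hhi' q hq' e).not_gt, iff_of_true e (hhi' q hq' e)⟩

/-- Off `Z` the projection is matched first, keeping depth `2 * r + 1`; hence `11 * (2 * r + 1) + 2
= 22 * r + 13`. -/
lemma exists_insert [DenselyOrdered M] [NoMinOrder M] [NoMaxOrder M]
    (hc : A.consts ⊆ R) (hfin : R.Finite) {r : ℕ}
    (hQ : A.PIso (A.cl R (22 * r + 13))) (a : M) :
    ∃ b, A.PIso (A.cl (insert (a, b) R) r) := by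
  by_cases ha : a ∈ A.Z
  · exact exists_insert_of_mem hc hfin (hQ.mono (cl_mono (by omega))) ha
  · obtain ⟨b₀, hb₀⟩ := exists_insert_of_mem (r := 2 * r + 1) hc hfin
      (hQ.mono (cl_mono (by omega))) (A.proj_mem a)
    obtain ⟨b, hb⟩ := exists_insert_of_notMem (hc.trans (Set.subset_insert _ _)) (hfin.insert _)
      hb₀ ha (Set.mem_insert _ _)
    exact ⟨b, hb.mono (cl_subset_of_subset (Set.insert_subset_insert (Set.subset_insert _ _)))⟩

/-! ### Invariance of formulas -/

variable (A) in
/-- Every symbol of `L` is interpreted in terms of the operations, constants and relations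
of `A`. -/
structure Interprets (L : FirstOrder.Language.{u, v}) [L.Structure M] : Prop where
  funMap : ∀ {n : ℕ} (F : L.Functions n),
    (∃ o ∈ A.ops, ∃ i, ∀ v : Fin n → M, Language.Structure.funMap F v = o (v i)) ∨
      ∃ c, (c, c) ∈ A.consts ∧ ∀ v : Fin n → M, Language.Structure.funMap F v = c
  relMap : ∀ {n : ℕ} (r : L.Relations n),
    (∃ i, ∀ v : Fin n → M, Language.Structure.RelMap r v ↔ v i ∈ A.Z) ∨
      ∃ i j, ∀ v : Fin n → M, Language.Structure.RelMap r v ↔ v i < v j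

variable {L : FirstOrder.Language.{u, v}} [L.Structure M]

lemma Interprets.exists_term_mem_cl (hA : A.Interprets L) {α : Type*} (t : L.Term α) :
    ∃ d, ∀ R : Set (M × M), A.consts ⊆ R → ∀ v v' : α → M, (∀ i, (v i, v' i) ∈ R) →
      (t.realize v, t.realize v') ∈ A.cl R d := by
  induction t with
  | var i => exact ⟨0, fun R _ v v' h => h i⟩
  | func F ts ih =>
    rcases hA.funMap F with ⟨o, ho, i, hF⟩ | ⟨c, hc, hF⟩
    · obtain ⟨d, hd⟩ := ih i
      refine ⟨d + 1, fun R hR v v' h => ?_⟩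
      rw [Language.Term.realize_func, Language.Term.realize_func, hF, hF]
      exact map_mem_cl ho (hd R hR v v' h)
    · refine ⟨0, fun R hR v v' _ => ?_⟩
      rw [Language.Term.realize_func, Language.Term.realize_func, hF, hF]
      exact hR hc

/-- Each quantifier costs one application of `exists_insert`. The depth depends on `φ` alone, so one
finite closure will serve all points at once. -/
lemma Interprets.exists_realize_iff [DenselyOrdered M] [NoMinOrder M] [NoMaxOrder M]
    (hA : A.Interprets L) {α : Type*} {n : ℕ} (φ : L.BoundedFormula α n) :
    ∃ N, ∀ R : Set (M × M), A.consts ⊆ R → R.Finite → A.PIso (A.cl R N) →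
      ∀ (v v' : α → M) (xs xs' : Fin n → M), (∀ i, (v i, v' i) ∈ R) →
        (∀ i, (xs i, xs' i) ∈ R) → (φ.Realize v xs ↔ φ.Realize v' xs') := by
  have hsum : ∀ {n : ℕ} {R : Set (M × M)} {v v' : α → M} {xs xs' : Fin n → M},
      (∀ i, (v i, v' i) ∈ R) → (∀ i, (xs i, xs' i) ∈ R) →
      ∀ i, (Sum.elim v xs i, Sum.elim v' xs' i) ∈ R := by
    rintro n R v v' xs xs' h h' (i | i)
    exacts [h i, h' i]
  induction φ with
  | falsum => exact ⟨0, fun _ _ _ _ _ _ _ _ _ _ => Iff.rfl⟩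
  | equal t₁ t₂ =>
    obtain ⟨d₁, h₁⟩ := hA.exists_term_mem_cl t₁
    obtain ⟨d₂, h₂⟩ := hA.exists_term_mem_cl t₂
    refine ⟨max d₁ d₂, fun R hc _ hR v v' xs xs' hv hxs => ?_⟩
    exact hR.eq_iff (cl_mono (le_max_left _ _) (h₁ R hc _ _ (hsum hv hxs)))
      (cl_mono (le_max_right _ _) (h₂ R hc _ _ (hsum hv hxs)))
  | rel r ts =>
    rcases hA.relMap r with ⟨i, hr⟩ | ⟨i, j, hr⟩
    · obtain ⟨d, hd⟩ := hA.exists_term_mem_cl (ts i)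
      refine ⟨d, fun R hc _ hR v v' xs xs' hv hxs => ?_⟩
      simp only [Language.BoundedFormula.Realize, hr]
      exact hR.mem_iff _ (hd R hc _ _ (hsum hv hxs))
    · obtain ⟨d₁, h₁⟩ := hA.exists_term_mem_cl (ts i)
      obtain ⟨d₂, h₂⟩ := hA.exists_term_mem_cl (ts j)
      refine ⟨max d₁ d₂, fun R hc _ hR v v' xs xs' hv hxs => ?_⟩
      simp only [Language.BoundedFormula.Realize, hr]
      exact hR.lt_iff _ (cl_mono (le_max_left _ _) (h₁ R hc _ _ (hsum hv hxs))) _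
        (cl_mono (le_max_right _ _) (h₂ R hc _ _ (hsum hv hxs)))
  | imp φ ψ ih₁ ih₂ =>
    obtain ⟨N₁, h₁⟩ := ih₁
    obtain ⟨N₂, h₂⟩ := ih₂
    refine ⟨max N₁ N₂, fun R hc hf hR v v' xs xs' hv hxs => ?_⟩
    exact imp_congr
      (h₁ R hc hf (hR.mono (cl_mono (le_max_left _ _))) v v' xs xs' hv hxs)
      (h₂ R hc hf (hR.mono (cl_mono (le_max_right _ _))) v v' xs xs' hv hxs)
  | all φ ih =>
    obtain ⟨N, hN⟩ := ih
    have key : ∀ R : Set (M × M), A.consts ⊆ R → R.Finite → A.PIso (A.cl R (22 * N + 13)) →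
        ∀ (v v' : α → M) (xs xs' : Fin _ → M), (∀ i, (v i, v' i) ∈ R) →
        (∀ i, (xs i, xs' i) ∈ R) → φ.all.Realize v' xs' → φ.all.Realize v xs := by
      intro R hc hf hR v v' xs xs' hv hxs h a
      obtain ⟨b, hb⟩ := exists_insert hc hf hR a
      have hsub := Set.subset_insert (a, b) R
      refine (hN _ (hc.trans hsub) (hf.insert _) hb v v' _ _ (fun i => hsub (hv i)) ?_).2 (h b)
      intro i
      refine Fin.lastCases ?_ (fun i => ?_) i
      · simp
      · simpa using .inr (hxs i)
    refine ⟨22 * N + 13, fun R hc hf hR v v' xs xs' hv hxs => ⟨?_, key R hc hf hR v v' xs xs' hv hxs⟩⟩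
    -- The hypotheses are symmetric in the two components, so the converse is `key` for the swapped
    -- pairs.
    refine key (Prod.swap ⁻¹' R) ?_ (hf.preimage Prod.swap_injective.injOn) ?_ v' v xs' xs hv hxs
    · intro p hp
      refine hc ?_
      simp only [consts, Set.mem_insert_iff, Set.mem_singleton_iff] at hp ⊢
      rcases hp with rfl | rfl | rfl | rfl <;> simp
    · rw [cl_swap]
      exact hR.swap

/-! ### Definable sets in one variable -/

lemma pIso_diag {Q : Set (M × M)} (h : ∀ p ∈ Q, p.1 = p.2) : A.PIso Q :=
  ⟨fun p hp q hq => by rw [h p hp, h q hq], fun p hp => by rw [h p hp]⟩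

/-- If `z` were a point of the closure, having the same position would force `z' = z`. So distinct
`z` and `z'` both avoid the closure and fill the same cut. -/
lemma pIso_cl_insert_of_diag (hc : A.consts ⊆ R) (hR : ∀ p ∈ R, p.1 = p.2) {r : ℕ} {z z' : M}
    (hz : z ∈ A.Z) (hz' : z' ∈ A.Z)
    (h : ∀ t ∈ A.cl R (10 * r + 1), (t.1 < z ↔ t.1 < z') ∧ (z < t.1 ↔ z' < t.1)) :
    A.PIso (A.cl (insert (z, z') R) r) := by
  have hd := cl_diag (A := A) hR (10 * r + 1)
  by_cases hzz : z = z'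
  · subst hzz
    refine pIso_diag (cl_diag ?_ r)
    rintro p (rfl | hp)
    exacts [rfl, hR p hp]
  · refine Cut.pIso_cl_insert hc le_rfl (pIso_diag hd) ⟨hz, hz', fun q hq _ => ?_⟩
    obtain ⟨h1, h2⟩ := h q hq
    rw [← hd q hq]
    refine ⟨h1, ?_, ?_⟩
    · rintro e
      rw [e] at h1 h2
      simp only [lt_irrefl, false_iff] at h1 h2
      exact hzz (by order)
    · rintro e
      rw [e] at h1 h2
      simp only [lt_irrefl, iff_false] at h1 h2
      exact hzz (by order)

lemma cl_singleton_mem {p : M × M} (hp : p.1 ∈ A.Z) (r : ℕ) : ∀ q ∈ A.cl {p} r, q.1 ∈ A.Z := by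
  induction r with
  | zero => rintro q rfl; exact hp
  | succ r ih =>
    rintro q (hq | ⟨o, ho, q, hq, rfl⟩)
    · exact ih q hq
    · have := ih q hq
      simp only [ops, Set.mem_insert_iff, Set.mem_singleton_iff] at ho
      rcases ho with rfl | rfl | rfl | rfl | rfl
      exacts [A.S_mem _ this, A.P_mem _ this, A.proj_mem _, A.f_mem _ this, A.g_mem _ this]

/-- For `x ∉ Z` the projections are inserted first. Their closure stays in `Z`, where comparisons
with `x` go through `proj`; points off `Z` come from the diagonal `R`. -/
lemma pIso_cl_insert_of_diag' (hc : A.consts ⊆ R) (hR : ∀ p ∈ R, p.1 = p.2) {r : ℕ} {x x' : M}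
    (hx : x ∈ A.Z ↔ x' ∈ A.Z)
    (h : ∀ t ∈ A.cl R (10 * r + 1), ((t.1 < x ↔ t.1 < x') ∧ (x < t.1 ↔ x' < t.1)) ∧
      (t.1 < A.proj x ↔ t.1 < A.proj x') ∧ (A.proj x < t.1 ↔ A.proj x' < t.1)) :
    A.PIso (A.cl (insert (x, x') R) r) := by
  by_cases hxZ : x ∈ A.Z
  · exact pIso_cl_insert_of_diag hc hR hxZ (hx.1 hxZ) fun t ht => (h t ht).1
  · have hxZ' := mt hx.2 hxZ
    have h1 := pIso_cl_insert_of_diag hc hR (A.proj_mem x) (A.proj_mem x')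
      fun t ht => (h t ht).2
    have k0 : (A.proj x, A.proj x') ∈ A.cl (insert (A.proj x, A.proj x') R) r :=
      subset_cl _ (Set.mem_insert _ _)
    have h4 : x < A.c4 ↔ x' < A.c4 := (h _ (subset_cl _ (hc c4_mem_consts))).1.2
    refine (PIso.insert_of_notMem h1 hxZ hxZ' (Set.mem_insert _ _) fun q hq => ?_).mono
      (cl_subset_of_subset (Set.insert_subset_insert (Set.subset_insert _ _)))
    by_cases hqZ : q.1 ∈ A.Z
    · have hqZ' := (h1.mem_iff q hq).1 hqZ
      have e1 : x < q.1 ↔ x' < q.2 := by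
        rw [lt_iff_proj hxZ hqZ, lt_iff_proj hxZ' hqZ', h4]
        simpa using fun _ => not_congr (h1.lt_iff q hq _ k0)
      refine ⟨?_, e1⟩
      have n1 : x ≠ q.1 := fun e => hxZ (e ▸ hqZ)
      have n2 : x' ≠ q.2 := fun e => hxZ' (e ▸ hqZ')
      have := not_congr e1
      rwa [not_lt, not_lt, n1.symm.le_iff_lt, n2.symm.le_iff_lt] at this
    · rcases cl_insert hq with hq | hq
      · have e := (h q (cl_mono (by omega) hq)).1
        rw [← cl_diag hR r q hq]
        exact e
      · exact absurd (cl_singleton_mem (A.proj_mem x) r q hq) hqZ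

/-- Membership in a definable subset of `M` is decided by membership in `Z` and the position of
`x` and `π(x)` relative to finitely many points. -/
theorem Interprets.exists_finite_mem_iff [DenselyOrdered M] [NoMinOrder M] [NoMaxOrder M]
    (hA : A.Interprets L) {X : Set M} (hX : Set.Definable₁ Set.univ L X) :
    ∃ T : Set M, T.Finite ∧ ∀ x x', (x ∈ A.Z ↔ x' ∈ A.Z) →
      (∀ t ∈ T, ((t < x ↔ t < x') ∧ (x < t ↔ x' < t)) ∧
        (t < A.proj x ↔ t < A.proj x') ∧ (A.proj x < t ↔ A.proj x' < t)) →
      (x ∈ X ↔ x' ∈ X) := by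
  classical
  obtain ⟨φ, hφ⟩ := Set.definable_iff_exists_formula_sum.1 hX
  have hmem : ∀ x, x ∈ X ↔ φ.Realize (Sum.elim (fun a : (Set.univ : Set M) => (a : M))
      fun _ : Fin 1 => x) := fun x => by
    have := Set.ext_iff.1 hφ (fun _ => x)
    simpa using this
  let ψ : L.Formula φ.freeVarFinset := Language.BoundedFormula.restrictFreeVar φ id
  have hψ : ∀ x, x ∈ X ↔ ψ.Realize fun i => Sum.elim (fun a : (Set.univ : Set M) => (a : M))
      (fun _ : Fin 1 => x) i := fun x => by
    rw [hmem]
    exact (Language.BoundedFormula.realize_restrictFreeVar (φ := φ) (f := id) _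
      fun _ => rfl).symm
  obtain ⟨N, hN⟩ := hA.exists_realize_iff ψ
  -- Only the finitely many parameters occurring in `φ` are kept; the object variable is sent to
  -- `c1`, which belongs to `R` anyway.
  let D : Set M := (Sum.elim (fun a : (Set.univ : Set M) => (a : M)) fun _ : Fin 1 => A.c1) ''
    φ.freeVarFinset
  have hD : D.Finite := (Finset.finite_toSet _).image _
  let R : Set (M × M) := A.consts ∪ (fun a => (a, a)) '' D
  have hRf : R.Finite := by
    refine Set.Finite.union ?_ (hD.image _)
    simp [consts]
  have hRd : ∀ p ∈ R, p.1 = p.2 := by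
    rintro p (hp | ⟨a, _, rfl⟩)
    · simp only [consts, Set.mem_insert_iff, Set.mem_singleton_iff] at hp
      rcases hp with rfl | rfl | rfl | rfl <;> rfl
    · rfl
  have hc : A.consts ⊆ R := Set.subset_union_left
  refine ⟨Prod.fst '' A.cl R (10 * N + 1), (cl_finite hRf _).image _, fun x x' hx h => ?_⟩
  rw [hψ, hψ]
  refine hN (insert (x, x') R) (hc.trans (Set.subset_insert _ _)) (hRf.insert _) ?_ _ _ _ _ ?_
    (fun i => i.elim0)
  · exact pIso_cl_insert_of_diag' hc hRd hx fun t ht => h _ ⟨t, ht, rfl⟩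
  · rintro ⟨i | i, hi⟩
    · exact .inr (.inr ⟨i, ⟨_, hi, rfl⟩, rfl⟩)
    · exact .inl rfl

end ShiftedRotation

/-- `X` is the union of those atoms of the finite Boolean algebra generated by the `D i` that it
meets. -/
lemma definable₁_of_finite_mem_iff {L : FirstOrder.Language.{u, v}} {M : Type w} [L.Structure M]
    {B : Set M} {ι : Type*} [Finite ι] {D : ι → Set M} (hD : ∀ i, B.Definable₁ L (D i)) {X : Set M}
    (hX : ∀ x y, (∀ i, x ∈ D i ↔ y ∈ D i) → (x ∈ X ↔ y ∈ X)) : B.Definable₁ L X := by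
  have key : {v : Fin 1 → M | v 0 ∈ X} = ⋃ s : {s : Set ι // ∃ x ∈ X, s = {i | x ∈ D i}},
      ⋂ i : ι, ({v : Fin 1 → M | v 0 ∈ D i ↔ i ∈ s.1}) := by
    ext v
    simp only [Set.mem_iUnion, Set.mem_iInter, Set.mem_ofPred_eq]
    constructor
    · exact fun h => ⟨⟨{i | v 0 ∈ D i}, v 0, h, rfl⟩, fun i => Iff.rfl⟩
    · rintro ⟨⟨_, x, hx, rfl⟩, h⟩
      exact (hX _ _ h).2 hx
  unfold Set.Definable₁
  rw [key]
  refine Set.definable_iUnion_of_finite fun s => Set.definable_iInter_of_finite fun i => ?_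
  by_cases hi : i ∈ s.1
  · simp only [hi, iff_true]; exact hD i
  · simp only [hi, iff_false]; exact Set.Definable.compl (hD i)

/-- The linear order given by a relation satisfying `IsDLO`. -/
@[reducible] noncomputable def IsDLO.linearOrder {M : Type w} {lt : M → M → Prop} (h : IsDLO lt) :
    LinearOrder M where
  le a b := lt a b ∨ a = b
  lt := lt
  le_refl a := .inr rfl
  le_trans := by
    rintro a b c (h1 | rfl) (h2 | rfl)
    exacts [.inl (h.trans _ _ _ h1 h2), .inl h1, .inl h2, .inr rfl]
  lt_iff_le_not_ge a b := by
    constructor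
    · intro h1
      refine ⟨.inl h1, ?_⟩
      rintro (h2 | rfl)
      exacts [h.irrefl _ (h.trans _ _ _ h1 h2), h.irrefl _ h1]
    · rintro ⟨h1 | rfl, h2⟩
      exacts [h1, absurd (.inr rfl) h2]
  le_antisymm := by
    rintro a b (h1 | rfl) (h2 | h2)
    exacts [absurd (h.trans _ _ _ h1 h2) (h.irrefl _), h2.symm, rfl, rfl]
  le_total a b := by
    rcases h.total a b with h1 | h1 | h1
    exacts [.inl (.inl h1), .inl (.inr h1), .inr (.inl h1)]
  toDecidableLE := Classical.decRel _

/-! ### Discreteness and cyclic order in models of `T₀` -/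

section Rotation

variable {M : Type w} [LinearOrder M] [L0.Structure M]

lemma le0_iff (hlt : (lt0 : M → M → Prop) = (· < ·)) {a b : M} : le0 a b ↔ a ≤ b := by
  unfold le0
  rw [hlt, le_iff_lt_or_eq]

namespace ModelsT0

variable (h : ModelsT0 M) (hlt : (lt0 : M → M → Prop) = (· < ·))
include h hlt

lemma c1_le {z : M} (hz : z ∈ Z0 M) : c1 M ≤ z := (le0_iff hlt).1 (h.min_eq.2 z hz)

lemma le_c4 {z : M} (hz : z ∈ Z0 M) : z ≤ c4 M := (le0_iff hlt).1 (h.max_eq.2 z hz)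

lemma lt12 : c1 M < c2 M := by simpa only [hlt] using h.c1_lt_c2

lemma lt23 : c2 M < c3 M := by simpa only [hlt] using h.c2_lt_c3

lemma lt34 : c3 M < c4 M := by simpa only [hlt] using h.c3_lt_c4

omit [LinearOrder M] hlt in
lemma S_off {x : M} (hx : x ∉ Z0 M) : S0 x = x := (h.S_spec x x).2 (.inl ⟨hx, rfl⟩)

lemma S_mem_spec {x : M} (hx : x ∈ Z0 M) :
    S0 x ∈ Z0 M ∧ x ≠ S0 x ∧ ∀ z ∈ Z0 M, ¬ Cyc (· < ·) x z (S0 x) := by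
  rcases (h.S_spec x (S0 x)).1 rfl with h1 | ⟨_, h2, h3, h4⟩
  · exact absurd hx h1.1
  · rw [hlt] at h4
    exact ⟨h2, h3, fun z hz hC => h4 ⟨z, hz, hC⟩⟩

lemma S_mem {x : M} (hx : x ∈ Z0 M) : S0 x ∈ Z0 M := (h.S_mem_spec hlt hx).1

omit [LinearOrder M] hlt in
lemma S_injective : Function.Injective (S0 : M → M) :=
  Function.LeftInverse.injective (g := P0) h.P_S

lemma lt_S {z : M} (hz : z ∈ Z0 M) (h4 : z ≠ c4 M) : z < S0 z := by
  have h5 := h.discrete_succ z hz ⟨c4 M, h.max_eq.1, by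
    rw [hlt]; exact lt_of_le_of_ne (h.le_c4 hlt hz) h4⟩
  rw [hlt] at h5
  obtain ⟨w, hw, hzw, hy⟩ := h5
  have : S0 z = w := by
    refine (h.S_spec z w).2 (.inr ⟨hz, hw, hzw.ne, ?_⟩)
    rw [hlt]
    rintro ⟨y, hyZ, hC⟩
    have := hy y hyZ
    unfold Cyc at hC
    rcases hC with h1 | h1 | h1
    · exact this h1
    · exact lt_asymm hzw h1.2
    · exact lt_asymm hzw h1.1
  rwa [this]

lemma S_le {z x : M} (hz : z ∈ Z0 M) (hx : x ∈ Z0 M) (hzx : z < x) : S0 z ≤ x := by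
  by_contra! h1
  exact (h.S_mem_spec hlt hz).2.2 x hx (.inl ⟨hzx, h1⟩)

lemma S_c4 : S0 (c4 M) = c1 M := by
  have h1 := ((h.lt12 hlt).trans (h.lt23 hlt)).trans (h.lt34 hlt)
  refine (h.S_spec _ _).2 (.inr ⟨h.max_eq.1, h.min_eq.1, h1.ne', ?_⟩)
  rw [hlt]
  rintro ⟨y, hy, hC⟩
  have h2 := h.c1_le hlt hy
  have h3 := h.le_c4 hlt hy
  unfold Cyc at hC
  rcases hC with h1 | h1 | h1 <;> order

omit [LinearOrder M] hlt in
lemma P_mem {z : M} (hz : z ∈ Z0 M) : P0 z ∈ Z0 M := by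
  by_contra h1
  have h2 := h.S_off h1
  rw [h.S_P] at h2
  exact h1 (h2 ▸ hz)

lemma P_lt {z : M} (hz : z ∈ Z0 M) (h1 : z ≠ c1 M) : P0 z < z := by
  have h2 := h.lt_S hlt (h.P_mem hz) fun e => h1 (by rw [← h.S_P z, e, h.S_c4 hlt])
  rwa [h.S_P] at h2

lemma le_P {z x : M} (hz : z ∈ Z0 M) (hx : x ∈ Z0 M) (hxz : x < z) : x ≤ P0 z := by
  by_contra! h1
  have h2 := h.S_le hlt (h.P_mem hz) hx h1
  rw [h.S_P] at h2
  order

lemma le_proj {x : M} (hx : x ≤ c4 M) : x ≤ proj0 x := by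
  by_contra! h1
  have h2 := (h.proj_spec x).2 _ h.max_eq.1
  rw [hlt] at h2
  rcases hx.eq_or_lt with rfl | hx
  · rw [h.proj_of_mem _ h.max_eq.1] at h1
    exact lt_irrefl _ h1
  · exact h2 (.inr (.inr ⟨h1, hx⟩))

lemma proj_le {x z : M} (hz : z ∈ Z0 M) (hxz : x ≤ z) : proj0 x ≤ z := by
  by_contra! h1
  have h2 := (h.proj_spec x).2 _ hz
  rw [hlt] at h2
  rcases hxz.eq_or_lt with rfl | hx
  · rw [h.proj_of_mem _ hz] at h1
    exact lt_irrefl _ h1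
  · exact h2 (.inl ⟨hx, h1⟩)

lemma proj_gt {x : M} (hx : c4 M < x) : proj0 x = c1 M := by
  obtain ⟨h1, h2⟩ := h.proj_spec x
  rw [hlt] at h2
  have h3 := h.le_c4 hlt h1
  by_contra h4
  exact h2 _ h.min_eq.1 (.inr (.inl ⟨lt_of_le_of_ne (h.c1_le hlt h1) (Ne.symm h4), by order⟩))

/-- Each further `S` adds at most the point `S0^[k] z`. Thus infinite cyclic intervals rule out
finite `S`-distance. -/
lemma cyc_finite {z : M} (hz : z ∈ Z0 M) (k : ℕ) :
    {x ∈ Z0 M | Cyc (· < ·) z x (S0^[k] z)}.Finite := by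
  induction k with
  | zero =>
    refine Set.finite_empty.subset ?_
    rintro x ⟨_, hC⟩
    simp only [Function.iterate_zero_apply, Cyc] at hC
    rcases hC with h1 | h1 | h1 <;> order
  | succ k ih =>
    refine (ih.insert (S0^[k] z)).subset ?_
    rintro x ⟨hx, hC⟩
    rw [Function.iterate_succ_apply'] at hC
    have hy : S0^[k] z ∈ Z0 M := by
      clear ih hC
      induction k with
      | zero => exact hz
      | succ k ih => rw [Function.iterate_succ_apply']; exact h.S_mem hlt ih
    obtain ⟨-, h1, h2⟩ := h.S_mem_spec hlt hy
    have h3 := h2 x hx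
    rw [Set.mem_insert_iff, or_iff_not_imp_left]
    refine fun h4 => ⟨hx, ?_⟩
    generalize S0^[k] z = y at *
    unfold Cyc at *
    grind

/-- Moving back from `x` in the cyclic order `x, y, z`, the first of the other points that can be
met is `z`. -/
lemma cyc_P {x y z : M} (hx : x ∈ Z0 M) (hy : y ∈ Z0 M) (hz : z ∈ Z0 M) (hne : P0 x ≠ z)
    (hC : Cyc (· < ·) x y z) : Cyc (· < ·) (P0 x) y z := by
  obtain ⟨-, h1, h2⟩ := h.S_mem_spec hlt (h.P_mem hx)
  have h3 := h2 y hy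
  have h4 := h2 z hz
  rw [h.S_P] at h1 h3 h4
  unfold Cyc at *
  grind

lemma cyc_iterate_P {x y z : M} (hx : x ∈ Z0 M) (hy : y ∈ Z0 M) (hz : z ∈ Z0 M)
    (hne : ∀ j, P0^[j] x ≠ z) (hC : Cyc (· < ·) x y z) (j : ℕ) :
    P0^[j] x ∈ Z0 M ∧ Cyc (· < ·) (P0^[j] x) y z := by
  induction j with
  | zero => exact ⟨hx, hC⟩
  | succ j ih =>
    have h1 := hne (j + 1)
    rw [Function.iterate_succ_apply'] at h1 ⊢
    exact ⟨h.P_mem ih.1, h.cyc_P hlt ih.1 hy hz h1 ih.2⟩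

omit [LinearOrder M] hlt in
lemma mem_of_iterate_S {x : M} {n : ℕ} (hx : S0^[n] x = c4 M) : x ∈ Z0 M := by
  by_contra h1
  rw [Function.iterate_fixed (h.S_off h1)] at hx
  exact h1 (hx ▸ h.max_eq.1)

lemma c3_lt_of_iterate_S {x : M} {n : ℕ} (hx : S0^[n] x = c4 M) : c3 M < x := by
  by_contra! h1
  refine h.inf34 ((h.cyc_finite hlt (h.mem_of_iterate_S hx) n).subset ?_)
  rintro z ⟨hz, h2, h3⟩
  rw [hlt] at h2 h3
  rw [hx]
  exact ⟨hz, .inl ⟨h1.trans_lt h2, h3⟩⟩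

end ModelsT0

/-! ### The shifted maps form a shifted rotation -/

section

omit [LinearOrder M] in
lemma shiftF_of_exists {f : M → M} {x : M} (hx : ∃ n : ℕ, S0^[n] x = c4 M) :
    shiftF f x = P0 (f x) := if_pos hx

omit [LinearOrder M] in
lemma shiftF_of_not_exists {f : M → M} {x : M} (hx : ¬ ∃ n : ℕ, S0^[n] x = c4 M) :
    shiftF f x = f x := if_neg hx

omit [LinearOrder M] in
lemma shiftG_of_exists {g : M → M} {x : M} (hx : ∃ n : ℕ, S0^[n] x = P0 (c3 M)) :
    shiftG g x = g (S0 x) := if_pos hx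

omit [LinearOrder M] in
lemma shiftG_of_not_exists {g : M → M} {x : M} (hx : ¬ ∃ n : ℕ, S0^[n] x = P0 (c3 M)) :
    shiftG g x = g x := if_neg hx

omit [LinearOrder M] in
lemma shiftF_eq_or (f : M → M) (x : M) : shiftF f x = f x ∨ shiftF f x = P0 (f x) := by
  by_cases hx : ∃ n : ℕ, S0^[n] x = c4 M
  exacts [.inr (shiftF_of_exists hx), .inl (shiftF_of_not_exists hx)]

variable {f g : M → M}

variable (h : ModelsT0 M) (hlt : (lt0 : M → M → Prop) = (· < ·)) (hfg : AxiomsFG M f g)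
include h hlt hfg

namespace AxiomsFG

lemma f_low {z : M} (hz : z ∈ Z0 M) (hz2 : z ≤ c2 M) : f z ∈ Z0 M ∧ c3 M ≤ f z := by
  have h1 : f z ∈ {z ∈ Z0 M | le0 (c3 M) z ∧ le0 z (c4 M)} := hfg.image12 ▸
    Set.mem_image_of_mem f ⟨hz, h.min_eq.2 z hz, (le0_iff hlt).2 hz2⟩
  exact ⟨h1.1, (le0_iff hlt).1 h1.2.1⟩

lemma f_high {z : M} (hz : z ∈ Z0 M) (hz2 : c2 M < z) : f z ∈ Z0 M ∧ f z < c3 M := by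
  have h1 : f z ∈ {z ∈ Z0 M | le0 (c1 M) z ∧ lt0 z (c3 M)} := hfg.image24 ▸
    Set.mem_image_of_mem f ⟨hz, by rwa [hlt], h.max_eq.2 z hz⟩
  rw [hlt] at h1
  exact ⟨h1.1, h1.2.2⟩

lemma f_mem {z : M} (hz : z ∈ Z0 M) : f z ∈ Z0 M :=
  (le_or_gt z (c2 M)).elim (fun h1 => (hfg.f_low h hlt hz h1).1)
    fun h1 => (hfg.f_high h hlt hz h1).1

omit [LinearOrder M] h hlt in
lemma g_mem {z : M} (hz : z ∈ Z0 M) : g z ∈ Z0 M := by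
  by_contra h1
  have h2 := hfg.f_id _ h1
  rw [hfg.f_g] at h2
  exact h1 (h2 ▸ hz)

omit [LinearOrder M] h hlt in
lemma g_off {z : M} (hz : z ∉ Z0 M) : g z = z := by
  conv_lhs => rw [← hfg.f_id z hz]
  exact hfg.g_f z

lemma lt_low {x y : M} (hx : x ∈ Z0 M) (hy : y ∈ Z0 M) (hx2 : x ≤ c2 M) (hy2 : y ≤ c2 M) :
    f x < f y ↔ x < y := by
  have := hfg.iso12 x ⟨hx, h.min_eq.2 x hx, (le0_iff hlt).2 hx2⟩ y
    ⟨hy, h.min_eq.2 y hy, (le0_iff hlt).2 hy2⟩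
  rw [hlt] at this
  exact this.symm

lemma lt_high {x y : M} (hx : x ∈ Z0 M) (hy : y ∈ Z0 M) (hx2 : c2 M < x) (hy2 : c2 M < y) :
    f x < f y ↔ x < y := by
  have := hfg.iso24 x ⟨hx, by rwa [hlt], h.max_eq.2 x hx⟩ y ⟨hy, by rwa [hlt], h.max_eq.2 y hy⟩
  rw [hlt] at this
  exact this.symm

lemma lt_iff {x y : M} (hx : x ∈ Z0 M) (hy : y ∈ Z0 M) :
    f x < f y ↔ (x < y ∧ (y ≤ c2 M ∨ c2 M < x)) ∨ (y ≤ c2 M ∧ c2 M < x) := by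
  rcases le_or_gt x (c2 M) with h1 | h1 <;> rcases le_or_gt y (c2 M) with h2 | h2
  · rw [hfg.lt_low h hlt hx hy h1 h2]; grind
  · have h3 := (hfg.f_low h hlt hx h1).2
    have h4 := (hfg.f_high h hlt hy h2).2
    grind
  · have h3 := (hfg.f_high h hlt hx h1).2
    have h4 := (hfg.f_low h hlt hy h2).2
    grind
  · rw [hfg.lt_high h hlt hx hy h1 h2]; grind

lemma cyc_of_cyc_f {x y z : M} (hx : x ∈ Z0 M) (hy : y ∈ Z0 M) (hz : z ∈ Z0 M)
    (hC : Cyc (· < ·) (f x) (f y) (f z)) : Cyc (· < ·) x y z := by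
  simp only [Cyc] at hC ⊢
  rw [hfg.lt_iff h hlt hx hy, hfg.lt_iff h hlt hy hz, hfg.lt_iff h hlt hz hx] at hC
  grind

/-- The map `f` exchanges two blocks of `Z` and is increasing on each, so it respects the cyclic
order and hence cyclic successors. -/
lemma commute_S : Function.Commute f S0 := by
  intro x
  by_cases hx : x ∈ Z0 M
  · obtain ⟨h1, h2, h3⟩ := h.S_mem_spec hlt hx
    refine ((h.S_spec (f x) (f (S0 x))).2 (.inr ⟨hfg.f_mem h hlt hx, hfg.f_mem h hlt h1,
      fun e => h2 (hfg.f_bij.1 e), ?_⟩)).symm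
    rw [hlt]
    rintro ⟨z, hz, hC⟩
    rw [← hfg.f_g z] at hC
    exact h3 _ (hfg.g_mem hz) (hfg.cyc_of_cyc_f h hlt hx (hfg.g_mem hz) h1 hC)
  · rw [h.S_off hx, hfg.f_id x hx, h.S_off hx]

lemma commute_P : Function.Commute f P0 := by
  intro x
  apply h.S_injective
  rw [h.S_P, ← (hfg.commute_S h hlt).eq, h.S_P]

lemma f_c4 : f (c4 M) = P0 (c3 M) := by
  have h1 := h.lt12 hlt
  have h2 := h.lt23 hlt
  have h3 := h.lt34 hlt
  have h5 := h.P_lt hlt h.c3_mem (h1.trans h2).ne'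
  have h6 : P0 (c3 M) ∈ f '' {z ∈ Z0 M | lt0 (c2 M) z ∧ le0 z (c4 M)} := by
    rw [hfg.image24, hlt]
    exact ⟨h.P_mem h.c3_mem, h.min_eq.2 _ (h.P_mem h.c3_mem), h5⟩
  obtain ⟨w, ⟨hw, hw2, -⟩, hfw⟩ := h6
  rw [hlt] at hw2
  rcases (h.le_c4 hlt hw).eq_or_lt with rfl | hw4
  · exact hfw
  · have h7 := (hfg.lt_high h hlt hw h.max_eq.1 hw2 (h2.trans h3)).2 hw4
    have h8 := hfg.f_high h hlt h.max_eq.1 (h2.trans h3)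
    rw [hfw] at h7
    have h9 := h.S_le hlt (h.P_mem h.c3_mem) h8.1 h7
    rw [h.S_P] at h9
    order

lemma iterate_f_mem {z : M} (hz : z ∈ Z0 M) (n : ℕ) : f^[n] z ∈ Z0 M := by
  induction n with
  | zero => exact hz
  | succ n ih => rw [Function.iterate_succ_apply']; exact hfg.f_mem h hlt ih

lemma far_ne {n : ℕ} (hn : 0 < n) {z : M} (hz : z ∈ Z0 M) (k l : ℕ) :
    S0^[k] (f^[n] z) ≠ S0^[l] z := by
  have key : ∀ n, 1 < n → ∀ k l, S0^[k] (f^[n] z) ≠ S0^[l] z := by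
    intro n hn k l e
    have hfar := hfg.far n hn z hz
    rw [hlt] at hfar
    rcases le_total k l with hkl | hkl
    · obtain ⟨m, rfl⟩ := Nat.exists_eq_add_of_le hkl
      rw [Function.iterate_add_apply] at e
      have e' := h.S_injective.iterate k e
      rw [e'] at hfar
      exact hfar.1 (h.cyc_finite hlt hz m)
    · obtain ⟨m, rfl⟩ := Nat.exists_eq_add_of_le hkl
      rw [Function.iterate_add_apply] at e
      have e' := h.S_injective.iterate l e
      have h1 := h.cyc_finite hlt (hfg.iterate_f_mem h hlt hz n) m
      rw [e'] at h1
      exact hfar.2 h1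
  -- The axiom `far` starts at exponent 2. A finite distance from `z` to `f z` would double to one
  -- from `z` to `f (f z)`.
  rcases Nat.lt_or_ge 1 n with h1 | h1
  · exact key n h1 k l
  · obtain rfl : n = 1 := by omega
    intro e
    have hc := hfg.commute_S h hlt
    refine key 2 one_lt_two (k + k) (l + l) ?_
    simp only [Function.iterate_succ_apply, Function.iterate_zero_apply] at e ⊢
    rw [Function.iterate_add_apply, ← (hc.iterate_right k).eq, e, (hc.iterate_right l).eq,
      ((Function.Commute.refl S0).iterate_iterate k l).eq, e, ← Function.iterate_add_apply]

lemma exists_iterate_shiftF (n : ℕ) (z : M) : ∃ j, (shiftF f)^[n] z = P0^[j] (f^[n] z) := by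
  induction n with
  | zero => exact ⟨0, rfl⟩
  | succ n ih =>
    obtain ⟨j, hj⟩ := ih
    have hc := (hfg.commute_P h hlt).iterate_right j
    rw [Function.iterate_succ_apply', Function.iterate_succ_apply', hj]
    rcases shiftF_eq_or f (P0^[j] (f^[n] z)) with e | e
    · exact ⟨j, by rw [e, hc.eq]⟩
    · exact ⟨j + 1, by rw [e, hc.eq, Function.iterate_succ_apply']⟩

lemma far_shiftF {n : ℕ} (hn : 0 < n) {z : M} (hz : z ∈ Z0 M) (k l : ℕ) :
    S0^[k] ((shiftF f)^[n] z) ≠ S0^[l] z := by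
  obtain ⟨j, hj⟩ := hfg.exists_iterate_shiftF h hlt n z
  intro e
  refine hfg.far_ne h hlt hn hz k (j + l) ?_
  have hSP : Function.RightInverse P0 (S0 : M → M) := h.S_P
  rw [Function.iterate_add_apply, ← e, hj,
    ((Function.Commute.refl S0).iterate_iterate j k).eq, hSP.iterate j]

/-- The shifted iterates arise from the original ones by finitely many steps of `P`, which cannot
meet points at infinite distance; the two points are moved back in turn. -/
lemma circular_shiftF {m n : ℕ} (hn : 0 < n) (hnm : n < m) {z : M} (hz : z ∈ Z0 M) :
    Cyc (· < ·) ((shiftF f)^[m] z) ((shiftF f)^[n] z) z := by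
  obtain ⟨j, hj⟩ := hfg.exists_iterate_shiftF h hlt m z
  obtain ⟨i, hi⟩ := hfg.exists_iterate_shiftF h hlt n z
  have hSP : Function.RightInverse P0 (S0 : M → M) := h.S_P
  have hm := hfg.iterate_f_mem h hlt hz m
  have hnZ := hfg.iterate_f_mem h hlt hz n
  have h0 := hfg.circular m n hn hnm z hz
  rw [hlt] at h0
  obtain ⟨h1, h2⟩ := h.cyc_iterate_P hlt hm hnZ hz (fun j e => by
    refine hfg.far_ne h hlt (hn.trans hnm) hz 0 j ?_
    exact (hSP.iterate j _).symm.trans (congrArg _ e)) h0 j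
  have h3 : Cyc (· < ·) (f^[n] z) z (P0^[j] (f^[m] z)) := by unfold Cyc at *; tauto
  obtain ⟨-, h4⟩ := h.cyc_iterate_P hlt hnZ hz h1 (fun i e => by
    obtain ⟨d, rfl⟩ := Nat.exists_eq_add_of_le' hnm.le
    refine hfg.far_ne h hlt (n := d) (by omega) hnZ i j ?_
    rw [← Function.iterate_add_apply, ← hSP.iterate i (f^[n] z), e,
      ((Function.Commute.refl S0).iterate_iterate j i).eq, hSP.iterate j]) h3 i
  rw [hj, hi]
  unfold Cyc at *; tauto

/-- As `f` commutes with `S` and sends `c4` to `P c3`, the case distinctions defining `shiftF` and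
`shiftG` correspond. -/
lemma exists_iterate_f_iff {x : M} :
    (∃ n : ℕ, S0^[n] (f x) = P0 (c3 M)) ↔ ∃ n : ℕ, S0^[n] x = c4 M := by
  refine exists_congr fun n => ?_
  rw [← ((hfg.commute_S h hlt).iterate_right n).eq, ← hfg.f_c4 h hlt, hfg.f_bij.1.eq_iff]

lemma shiftG_shiftF (x : M) : shiftG g (shiftF f x) = x := by
  by_cases hx : ∃ n : ℕ, S0^[n] x = c4 M
  · obtain ⟨n, hn⟩ := (hfg.exists_iterate_f_iff h hlt).2 hx
    rw [shiftF_of_exists hx, shiftG_of_exists ⟨n + 1, by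
      rw [Function.iterate_succ_apply, h.S_P, hn]⟩, h.S_P, hfg.g_f]
  · rw [shiftF_of_not_exists hx, shiftG_of_not_exists
      (mt (hfg.exists_iterate_f_iff h hlt).1 hx), hfg.g_f]

lemma shiftF_shiftG {x : M} (hne : x ≠ P0 (c3 M)) : shiftF f (shiftG g x) = x := by
  have key := fun y => hfg.exists_iterate_f_iff h hlt (x := g y)
  simp only [hfg.f_g] at key
  by_cases hx : ∃ n : ℕ, S0^[n] x = P0 (c3 M)
  · rw [shiftG_of_exists hx, shiftF_of_exists, hfg.f_g, h.P_S]
    rw [← key]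
    obtain ⟨n, hn⟩ := hx
    cases n with
    | zero => exact absurd hn hne
    | succ n => exact ⟨n, by rwa [Function.iterate_succ_apply] at hn⟩
  · rw [shiftG_of_not_exists hx, shiftF_of_not_exists (mt (key x).2 hx), hfg.f_g]

lemma shiftF_S {x : M} (hx : x ≠ c4 M) : shiftF f (S0 x) = S0 (shiftF f x) := by
  have hiff : (∃ n : ℕ, S0^[n] (S0 x) = c4 M) ↔ ∃ n : ℕ, S0^[n] x = c4 M := by
    constructor
    · rintro ⟨n, hn⟩
      exact ⟨n + 1, hn⟩
    · rintro ⟨n, hn⟩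
      cases n with
      | zero => exact absurd hn hx
      | succ n => exact ⟨n, hn⟩
  have hc := (hfg.commute_S h hlt).eq x
  by_cases ht : ∃ n : ℕ, S0^[n] x = c4 M
  · rw [shiftF_of_exists (hiff.2 ht), shiftF_of_exists ht, hc, h.P_S, h.S_P]
  · rw [shiftF_of_not_exists (mt hiff.1 ht), shiftF_of_not_exists ht, hc]

/-- Ensures that the shift by `P` does not wrap around at `c1`. -/
lemma c1_lt_f {x : M} (hx : x ∈ Z0 M) (hx3 : c3 M < x) : c1 M < f x := by
  have h2 := h.lt23 hlt
  exact (h.c1_le hlt (hfg.f_mem h hlt h.c3_mem)).trans_lt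
    ((hfg.lt_high h hlt h.c3_mem hx h2 (h2.trans hx3)).2 hx3)

lemma shiftF_lt {x : M} (hx : x ∈ Z0 M) (hx2 : c2 M < x) : shiftF f x < P0 (c3 M) := by
  obtain ⟨h1, h3⟩ := hfg.f_high h hlt hx hx2
  have h4 := h.le_P hlt h.c3_mem h1 h3
  by_cases ht : ∃ n : ℕ, S0^[n] x = c4 M
  · obtain ⟨n, hn⟩ := ht
    rw [shiftF_of_exists ⟨n, hn⟩]
    exact (h.P_lt hlt h1 (hfg.c1_lt_f h hlt hx (h.c3_lt_of_iterate_S hlt hn)).ne').trans_le h4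
  · rw [shiftF_of_not_exists ht]
    refine lt_of_le_of_ne h4 fun e => ht ⟨0, ?_⟩
    rw [← hfg.f_c4 h hlt] at e
    exact hfg.f_bij.1 e

omit hfg in
lemma shiftF_of_le {x : M} (hx2 : x ≤ c2 M) : shiftF f x = f x := by
  refine shiftF_of_not_exists ?_
  rintro ⟨n, hn⟩
  have h1 := h.c3_lt_of_iterate_S hlt hn
  have h2 := h.lt23 hlt
  order

/-- The critical case is that only `y` is shifted: `f x = P (f y)` would give `S x = y`, and then
`x` would reach `c4` as well. -/
lemma shiftF_lt_shiftF {x y : M} (hx : x ∈ Z0 M) (hy : y ∈ Z0 M) (hx2 : c2 M < x) (hxy : x < y) :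
    shiftF f x < shiftF f y := by
  have hfx := hfg.f_mem h hlt hx
  have hfy := hfg.f_mem h hlt hy
  have hf := (hfg.lt_high h hlt hx hy hx2 (hx2.trans hxy)).2 hxy
  have h1 : ∀ z ∈ Z0 M, (∃ n : ℕ, S0^[n] z = c4 M) → P0 (f z) < f z := by
    rintro z hz ⟨n, hn⟩
    exact h.P_lt hlt (hfg.f_mem h hlt hz)
      (hfg.c1_lt_f h hlt hz (h.c3_lt_of_iterate_S hlt hn)).ne'
  by_cases hty : ∃ n : ℕ, S0^[n] y = c4 M
  · rw [shiftF_of_exists hty]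
    have h2 := h.le_P hlt hfy hfx hf
    by_cases htx : ∃ n : ℕ, S0^[n] x = c4 M
    · rw [shiftF_of_exists htx]
      exact (h1 x hx htx).trans_le h2
    · rw [shiftF_of_not_exists htx]
      refine lt_of_le_of_ne h2 fun e => htx ?_
      have h3 : f (S0 x) = f y := by rw [(hfg.commute_S h hlt).eq, e, h.S_P]
      obtain ⟨n, hn⟩ := hty
      rw [← hfg.f_bij.1 h3] at hn
      exact ⟨n + 1, hn⟩
  · rw [shiftF_of_not_exists hty]
    by_cases htx : ∃ n : ℕ, S0^[n] x = c4 M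
    · rw [shiftF_of_exists htx]
      exact (h1 x hx htx).trans hf
    · rwa [shiftF_of_not_exists htx]

lemma shiftF_mem {z : M} (hz : z ∈ Z0 M) : shiftF f z ∈ Z0 M := by
  have h1 := hfg.f_mem h hlt hz
  rcases shiftF_eq_or f z with e | e <;> rw [e]
  exacts [h1, h.P_mem h1]

lemma shiftG_mem {z : M} (hz : z ∈ Z0 M) : shiftG g z ∈ Z0 M := by
  by_cases hx : ∃ n : ℕ, S0^[n] z = P0 (c3 M)
  · rw [shiftG_of_exists hx]; exact hfg.g_mem (h.S_mem hlt hz)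
  · rw [shiftG_of_not_exists hx]; exact hfg.g_mem hz

omit [LinearOrder M] hlt in
lemma shiftF_off {x : M} (hx : x ∉ Z0 M) : shiftF f x = x := by
  rw [shiftF_of_not_exists fun ⟨_, hn⟩ => hx (h.mem_of_iterate_S hn), hfg.f_id x hx]

omit [LinearOrder M] hlt in
lemma shiftG_off {x : M} (hx : x ∉ Z0 M) : shiftG g x = x := by
  by_cases ht : ∃ n : ℕ, S0^[n] x = P0 (c3 M)
  · rw [shiftG_of_exists ht, h.S_off hx, hfg.g_off hx]
  · rw [shiftG_of_not_exists ht, hfg.g_off hx]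

/-- The shifted rotation of `𝓜₂`. -/
noncomputable def shiftedRotation : ShiftedRotation M where
  Z := Z0 M
  S := S0
  P := P0
  proj := proj0
  f := shiftF f
  g := shiftG g
  c1 := c1 M
  c2 := c2 M
  c3 := c3 M
  c4 := c4 M
  c1_mem := h.min_eq.1
  c2_mem := h.c2_mem
  c3_mem := h.c3_mem
  c4_mem := h.max_eq.1
  c1_le _ hz := h.c1_le hlt hz
  le_c4 _ hz := h.le_c4 hlt hz
  c1_lt_c2 := h.lt12 hlt
  c2_lt_c3 := h.lt23 hlt
  c3_lt_c4 := h.lt34 hlt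
  P_S := h.P_S
  S_P := h.S_P
  S_mem _ hz := h.S_mem hlt hz
  P_mem _ hz := h.P_mem hz
  S_off _ hx := h.S_off hx
  lt_S _ hz h4 := h.lt_S hlt hz h4
  S_le _ hz _ hw := h.S_le hlt hz hw
  S_c4 := h.S_c4 hlt
  proj_mem x := (h.proj_spec x).1
  proj_of_mem := h.proj_of_mem
  le_proj _ hx := h.le_proj hlt hx
  proj_le _ _ hz := h.proj_le hlt hz
  proj_gt _ hx := h.proj_gt hlt hx
  f_mem _ hz := hfg.shiftF_mem h hlt hz
  g_mem _ hz := hfg.shiftG_mem h hlt hz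
  f_off _ hx := hfg.shiftF_off h hx
  g_off _ hx := hfg.shiftG_off h hx
  g_f := hfg.shiftG_shiftF h hlt
  f_g _ hx := hfg.shiftF_shiftG h hlt hx
  c3_le_f z hz hz2 := by
    rw [shiftF_of_le h hlt hz2]
    exact (hfg.f_low h hlt hz hz2).2
  f_lt _ hz hz2 := hfg.shiftF_lt h hlt hz hz2
  f_mono_low x hx y hy hy2 hxy := by
    rw [shiftF_of_le h hlt hy2, shiftF_of_le h hlt (hxy.le.trans hy2)]
    exact (hfg.lt_low h hlt hx hy (hxy.le.trans hy2) hy2).2 hxy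
  f_mono_high _ hx _ hy hx2 hxy := hfg.shiftF_lt_shiftF h hlt hx hy hx2 hxy
  f_S _ hx := hfg.shiftF_S h hlt hx
  circ _ _ hn hnm _ hz := hfg.circular_shiftF h hlt hn hnm hz
  far _ hn _ hz k l := hfg.far_shiftF h hlt hn hz k l

end AxiomsFG

end

end Rotation

/-! ### Definability in `𝓜₀` and the conclusion -/

lemma definable₁_of_realize {L : FirstOrder.Language.{u, v}} {M : Type w} [L.Structure M]
    (φ : L.Formula ((Set.univ : Set M) ⊕ Fin 1)) {X : Set M}
    (hφ : ∀ x, x ∈ X ↔ φ.Realize (Sum.elim Subtype.val fun _ => x)) :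
    Set.univ.Definable₁ L X := by
  refine Set.definable_iff_exists_formula_sum.2 ⟨φ, ?_⟩
  ext v
  have : v = fun _ => v 0 := funext fun i => by rw [Subsingleton.elim i 0]
  rw [this]
  exact hφ (v 0)

lemma definable₁_of_term_lt {M : Type w} [L0.Structure M]
    (t s : L0.Term ((Set.univ : Set M) ⊕ Fin 1)) {X : Set M}
    (hX : ∀ x, x ∈ X ↔ lt0 (t.realize (Sum.elim Subtype.val fun _ => x))
      (s.realize (Sum.elim Subtype.val fun _ => x))) :
    Set.univ.Definable₁ L0 X :=
  definable₁_of_realize (Language.Relations.formula₂ (L := L0) Rel0.lt t s) fun x =>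
    (hX x).trans Language.Formula.realize_rel₂.symm

lemma definable₁_relMap {L : FirstOrder.Language.{u, v}} {M : Type w} [L.Structure M]
    (r : L.Relations 1) : Set.univ.Definable₁ L {x : M | Language.Structure.RelMap r ![x]} :=
  definable₁_of_realize (Language.Relations.formula₁ r (Language.Term.var (.inr 0))) fun x => by
    rw [Language.Formula.realize_rel₁]; rfl

lemma definable₁_Z0 {M : Type w} [L0.Structure M] : Set.univ.Definable₁ L0 (Z0 M) :=
  definable₁_relMap (L := L0) Rel0.Z

lemma interprets_structure2 {M : Type w} (𝓜₁ : L1.Structure M) (h : ModelsT1 𝓜₁)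
    [LinearOrder M] (hlt : (@lt0 M (reduct0 𝓜₁)) = (· < ·)) :
    let := reduct0 𝓜₁
    @ShiftedRotation.Interprets M _ (h.axiomsFG.shiftedRotation h.modelsT0 hlt) L1
      (structure2 𝓜₁) := by
  let := reduct0 𝓜₁
  let := structure2 𝓜₁
  have h1 : ∀ v : Fin 1 → M, v = ![v 0] := fun v => funext fun i => by
    rw [Subsingleton.elim i 0]; rfl
  have h2 : ∀ v : Fin 2 → M, v = ![v 0, v 1] := fun v => funext fun i => by
    fin_cases i <;> rfl
  have h0 : ∀ v : Fin 0 → M, v = ![] := fun v => Subsingleton.elim _ _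
  refine ⟨fun {n} F => ?_, fun {n} r => ?_⟩
  · rcases F with F | F
    · cases F with
      | c1 => exact .inr ⟨_, ShiftedRotation.c1_mem_consts, fun v => by rw [h0 v]; rfl⟩
      | c2 => exact .inr ⟨_, ShiftedRotation.c2_mem_consts, fun v => by rw [h0 v]; rfl⟩
      | c3 => exact .inr ⟨_, ShiftedRotation.c3_mem_consts, fun v => by rw [h0 v]; rfl⟩
      | c4 => exact .inr ⟨_, ShiftedRotation.c4_mem_consts, fun v => by rw [h0 v]; rfl⟩
      | S => exact .inl ⟨_, ShiftedRotation.S_mem_ops, 0, fun v => by rw [h1 v]; rfl⟩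
      | P => exact .inl ⟨_, ShiftedRotation.P_mem_ops, 0, fun v => by rw [h1 v]; rfl⟩
      | proj => exact .inl ⟨_, ShiftedRotation.proj_mem_ops, 0, fun v => by rw [h1 v]; rfl⟩
    · cases F with
      | f => exact .inl ⟨_, ShiftedRotation.f_mem_ops, 0, fun v => rfl⟩
      | g => exact .inl ⟨_, ShiftedRotation.g_mem_ops, 0, fun v => rfl⟩
  · rcases r with r | r
    · cases r with
      | Z => exact .inl ⟨0, fun v => by rw [h1 v]; exact Iff.rfl⟩
      | lt => exact .inr ⟨0, 1, fun v => by rw [h2 v]; exact iff_of_eq (congrFun₂ hlt _ _)⟩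
    · exact r.elim

/-- Every subset of `M` definable in `𝓜₂` is definable in `𝓜₀`. -/
theorem definable₁_reduct0_of_structure2 {M : Type*} (𝓜₁ : L1.Structure M)
    (h : ModelsT1 𝓜₁) (X : Set M)
    (hX : @Set.Definable₁ M Set.univ L1 (structure2 𝓜₁) X) :
    @Set.Definable₁ M Set.univ L0 (reduct0 𝓜₁) X := by
  let := reduct0 𝓜₁
  have hdlo := h.modelsT0.dlo
  let : LinearOrder M := hdlo.linearOrder
  have hlt : (lt0 : M → M → Prop) = (· < ·) := rfl
  have : DenselyOrdered M := ⟨hdlo.dense⟩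
  have : NoMinOrder M := ⟨hdlo.no_min⟩
  have : NoMaxOrder M := ⟨hdlo.no_max⟩
  obtain ⟨T, hT, hTX⟩ := @ShiftedRotation.Interprets.exists_finite_mem_iff M _ _ L1
    (structure2 𝓜₁) _ _ _ (interprets_structure2 𝓜₁ h hlt) X hX
  have : Finite T := hT
  let D : Option (T × Fin 4) → Set M := fun i => i.elim (Z0 M) fun p =>
    ![{x | lt0 p.1.1 x}, {x | lt0 x p.1.1}, {x | lt0 p.1.1 (proj0 x)},
      {x | lt0 (proj0 x) p.1.1}] p.2
  refine definable₁_of_finite_mem_iff (D := D) ?_ fun x y hxy => hTX x y (hxy none) fun t ht =>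
    ⟨⟨hxy (some (⟨t, ht⟩, 0)), hxy (some (⟨t, ht⟩, 1))⟩, hxy (some (⟨t, ht⟩, 2)),
      hxy (some (⟨t, ht⟩, 3))⟩
  let X₀ : L0.Term ((Set.univ : Set M) ⊕ Fin 1) := Language.Term.var (.inr 0)
  let pX : L0.Term ((Set.univ : Set M) ⊕ Fin 1) :=
    Language.Functions.apply₁ (L := L0) Func0.proj X₀
  have hpX : ∀ x : M, pX.realize (Sum.elim Subtype.val fun _ => x) = proj0 x := fun x =>
    Language.Term.realize_functions_apply₁
  rintro (_ | ⟨t, i⟩)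
  · exact definable₁_Z0
  · let c : L0.Term ((Set.univ : Set M) ⊕ Fin 1) := Language.Term.var (.inl ⟨t, trivial⟩)
    fin_cases i
    · exact definable₁_of_term_lt c X₀ fun x => Iff.rfl
    · exact definable₁_of_term_lt X₀ c fun x => Iff.rfl
    · exact definable₁_of_term_lt c pX fun x => by rw [hpX]; rfl
    · exact definable₁_of_term_lt pX c fun x => by rw [hpX]; rfl

end PseudoOMin

theorem mainTheorem4 {M : Type*} (𝓜₁ : PseudoOMin.L1.Structure M)
    (h : PseudoOMin.ModelsT1 𝓜₁) (X : Set M)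
    (hX : @Set.Definable₁ M Set.univ PseudoOMin.L1 (PseudoOMin.structure2 𝓜₁) X) :
    @Set.Definable₁ M Set.univ PseudoOMin.L0 (PseudoOMin.reduct0 𝓜₁) X :=
  PseudoOMin.definable₁_reduct0_of_structure2 𝓜₁ h X hX
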